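/- Let $1\le p<\infty$, $p\ne 2$, let $D$ be the open unit disc and $T$ the unit circle, and let $H^p$ be the Hardy space of analytic functions $f$ on $D$ with $\|f\|_p^p=\sup_{0<r<1}\int_T|f(r\zeta)|^p\,dm(\zeta)<\infty$, where $m$ is normalized Lebesgue measure on $T$. Let $$\phi(z)=\frac{\lambda(z-a)}{1-\overline a z},\qquad |\lambda|=1,\ a\in D,$$ be an automorphism of $D$ which is either parabolic (it has exactly one fixed point in $\overline D$, and this point lies on $T$) or hyperbolic (it is not the identity and has two distinct fixed points on $T$). Put $U_\phi f=(\overline\lambda\,\phi')^{1/p}\,(f\circ\phi)$, with the principal branch of the power, and $M_\Psi f=\Psi f$. An infinite Blaschke product is a function of the form $\prod_{k=1}^\infty b_k$, converging locally uniformly on $D$, where each $b_k$ is an automorphism of $D$ with zero $a_k$ and $\sum_k(1-|a_k|)<\infty$. For every infinite Blaschke product $\Psi$ the operator $S=M_\Psi U_\phi$ is a linear isometry of $H^p$ into itself whose range has infinite codimension in $H^p$. Depending on the choice of $\Psi$, both of the following occur: (i) there is an infinite Blaschke product $\Psi$ such that $\bigcap_{n=1}^\infty S^nH^p=\{0\}$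 for $S=M_\Psi U_\phi$; (ii) there is an infinite Blaschke product $\Psi$ such that $\bigcap_{n=1}^\infty S^nH^p\ne\{0\}$ for $S=M_\Psi U_\phi$. -/

import Mathlib

open scoped Complex.UnitDisc

namespace HardyIsometry

/-! ### Automorphisms of the unit disc -/

/-- A holomorphic automorphism `z ↦ λ (z - a) / (1 - conj a * z)` of the unit disc,
given by its (uniquely determined) parameters `a` in the open disc and `λ` on the unit circle. -/
structure DiscAut where
  /-- the zero of the automorphism -/
  a : 𝔻
  /-- the unimodular factor -/
  lam : Circle

/-- The Moebius formula of the automorphism, as a function on the plane.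
On the closed unit disc its denominator does not vanish. -/
noncomputable def DiscAut.eval (φ : DiscAut) (z : ℂ) : ℂ :=
  (φ.lam : ℂ) * (z - (φ.a : ℂ)) / (1 - (starRingEnd ℂ) (φ.a : ℂ) * z)

theorem DiscAut.norm_eval_lt_one (φ : DiscAut) (z : ℂ) (hz : ‖z‖ < 1) : ‖φ.eval z‖ < 1 := by
  have ha := φ.a.norm_lt_one
  have hd : ‖(starRingEnd ℂ) (φ.a : ℂ) * z‖ < 1 := by
    rw [norm_mul, RCLike.norm_conj]
    nlinarith [norm_nonneg z, norm_nonneg (φ.a : ℂ)]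
  have hne : (1 - (starRingEnd ℂ) (φ.a : ℂ) * z) ≠ 0 := by
    intro h
    rw [← sub_eq_zero.1 h, norm_one] at hd
    exact lt_irrefl _ hd
  rw [DiscAut.eval, norm_div, norm_mul, Circle.norm_coe, one_mul,
    div_lt_one (norm_pos_iff.2 hne)]
  refine lt_of_pow_lt_pow_left₀ 2 (norm_nonneg _) ?_
  have h1 : (φ.a : ℂ).re ^ 2 + (φ.a : ℂ).im ^ 2 < 1 := by
    have := φ.a.normSq_lt_one
    rw [Complex.normSq_apply] at this
    nlinarith
  have h2 : z.re ^ 2 + z.im ^ 2 < 1 := by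
    have : ‖z‖ ^ 2 < 1 := by nlinarith [norm_nonneg z]
    rw [← Complex.normSq_eq_norm_sq, Complex.normSq_apply] at this
    nlinarith
  rw [← Complex.normSq_eq_norm_sq, ← Complex.normSq_eq_norm_sq, Complex.normSq_apply,
    Complex.normSq_apply]
  simp only [Complex.sub_re, Complex.sub_im, Complex.one_re, Complex.one_im, Complex.mul_re,
    Complex.mul_im, Complex.conj_re, Complex.conj_im]
  nlinarith [mul_pos (sub_pos.2 h1) (sub_pos.2 h2)]

/-- The automorphism as a self-map of the open unit disc. -/
noncomputable def DiscAut.map (φ : DiscAut) (z : 𝔻) : 𝔻 :=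
  Complex.UnitDisc.mk (φ.eval z) (φ.norm_eval_lt_one z z.norm_lt_one)

/-- `φ` is parabolic: it has exactly one fixed point in the closed unit disc, and this point lies
on the unit circle. -/
def DiscAut.IsParabolic (φ : DiscAut) : Prop :=
  ∃ w : ℂ, ‖w‖ = 1 ∧ ∀ z : ℂ, ‖z‖ ≤ 1 → (φ.eval z = z ↔ z = w)

/-- `φ` is hyperbolic: it is not the identity and has two distinct fixed points on the unit
circle. -/
def DiscAut.IsHyperbolic (φ : DiscAut) : Prop :=
  (∃ z : 𝔻, φ.map z ≠ z) ∧
    ∃ w₁ w₂ : ℂ, w₁ ≠ w₂ ∧ ‖w₁‖ = 1 ∧ ‖w₂‖ = 1 ∧ φ.eval w₁ = w₁ ∧ φ.eval w₂ = w₂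

/-! ### Hardy spaces -/

open Classical in
/-- Extension by zero of a function on the open unit disc to the plane. -/
noncomputable def zeroExt (f : 𝔻 → ℂ) (z : ℂ) : ℂ :=
  if hz : ‖z‖ < 1 then f (Complex.UnitDisc.mk z hz) else 0

/-- `f` is analytic on the open unit disc. -/
def IsAnalytic (f : 𝔻 → ℂ) : Prop :=
  DifferentiableOn ℂ (zeroExt f) (Metric.ball 0 1)

/-- The mean of `|f| ^ p` over the circle of radius `r` with respect to normalized Lebesgue
measure. -/
noncomputable def hpMean (p : ℝ) (f : 𝔻 → ℂ) (r : ℝ) : ℝ :=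
  Real.circleAverage (fun z : ℂ => ‖zeroExt f z‖ ^ p) 0 r

/-- The Hardy space norm: the supremum over `0 < r < 1` of the `p`-th means, to the power `1/p`. -/
noncomputable def hpNorm (p : ℝ) (f : 𝔻 → ℂ) : ℝ :=
  (⨆ r : Set.Ioo (0 : ℝ) 1, hpMean p f r) ^ (1 / p)

theorem circleIntegrable_of_isAnalytic {p : ℝ} (hp : 1 ≤ p) {f : 𝔻 → ℂ} (hf : IsAnalytic f)
    {r : ℝ} (hr : r ∈ Set.Ioo (0 : ℝ) 1) :
    CircleIntegrable (fun z : ℂ => ‖zeroExt f z‖ ^ p) 0 r := by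
  refine ContinuousOn.circleIntegrable hr.1.le ?_
  refine ContinuousOn.rpow_const ?_ (fun _ _ => Or.inr (by linarith))
  refine (hf.continuousOn.mono ?_).norm
  exact (Metric.sphere_subset_closedBall).trans (Metric.closedBall_subset_ball hr.2)

theorem zeroExt_add (f g : 𝔻 → ℂ) : zeroExt (f + g) = zeroExt f + zeroExt g := by
  funext z
  simp only [zeroExt, Pi.add_apply]
  split_ifs <;> simp

theorem zeroExt_smul (c : ℂ) (f : 𝔻 → ℂ) : zeroExt (c • f) = c • zeroExt f := by
  funext z
  simp only [zeroExt, Pi.smul_apply]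
  split_ifs <;> simp

theorem zeroExt_zero : zeroExt 0 = 0 := by
  funext z
  simp [zeroExt]

/-- The Hardy space `H^p` of the unit disc: the analytic functions whose `p`-th means over the
circles of radius `0 < r < 1` are bounded. -/
noncomputable def Hp (p : ℝ) (hp : 1 ≤ p) : Submodule ℂ (𝔻 → ℂ) where
  carrier := {f | IsAnalytic f ∧ ∃ C : ℝ, ∀ r ∈ Set.Ioo (0 : ℝ) 1, hpMean p f r ≤ C}
  zero_mem' := by
    refine ⟨?_, 0, fun r _ => ?_⟩
    · rw [IsAnalytic, zeroExt_zero]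
      exact differentiableOn_const 0
    · have h0 : (0 : ℝ) ^ p = 0 := Real.zero_rpow (by linarith)
      simp [hpMean, zeroExt_zero, h0, Real.circleAverage_const]
  add_mem' := by
    rintro f g ⟨hf, C, hC⟩ ⟨hg, D, hD⟩
    have hfg : IsAnalytic (f + g) := by
      rw [IsAnalytic, zeroExt_add]
      exact hf.add hg
    refine ⟨hfg, 2 ^ p * (C + D), fun r hr => ?_⟩
    have If := circleIntegrable_of_isAnalytic hp hf hr
    have Ig := circleIntegrable_of_isAnalytic hp hg hr
    have key : hpMean p (f + g) r ≤
        Real.circleAverage ((2 : ℝ) ^ p • ((fun z : ℂ => ‖zeroExt f z‖ ^ p) +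
          (fun z : ℂ => ‖zeroExt g z‖ ^ p))) 0 r := by
      refine Real.circleAverage_mono (circleIntegrable_of_isAnalytic hp hfg hr)
        ((If.add Ig).const_smul) (fun z _ => ?_)
      simp only [zeroExt_add, Pi.add_apply, Pi.smul_apply, smul_eq_mul]
      set x := zeroExt f z
      set y := zeroExt g z
      have hp0 : 0 ≤ p := by linarith
      have h1 : ‖x + y‖ ≤ 2 * max ‖x‖ ‖y‖ := by
        have := norm_add_le x y
        have := le_max_left ‖x‖ ‖y‖
        have := le_max_right ‖x‖ ‖y‖
        linarith
      have hm : 0 ≤ max ‖x‖ ‖y‖ := (norm_nonneg x).trans (le_max_left _ _)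
      refine (Real.rpow_le_rpow (norm_nonneg _) h1 hp0).trans ?_
      rw [Real.mul_rpow (by norm_num) hm]
      refine mul_le_mul_of_nonneg_left ?_ (by positivity)
      have hx : 0 ≤ ‖x‖ ^ p := by positivity
      have hy : 0 ≤ ‖y‖ ^ p := by positivity
      rcases max_choice ‖x‖ ‖y‖ with h | h <;> rw [h] <;> linarith
    rw [Real.circleAverage_smul, Real.circleAverage_add If Ig, smul_eq_mul] at key
    refine key.trans (mul_le_mul_of_nonneg_left ?_ (by positivity))
    exact add_le_add (hC r hr) (hD r hr)
  smul_mem' := by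
    rintro c f ⟨hf, C, hC⟩
    refine ⟨?_, ‖c‖ ^ p * C, fun r hr => ?_⟩
    · rw [IsAnalytic, zeroExt_smul]
      exact hf.const_smul c
    · have h : (fun z : ℂ => ‖zeroExt (c • f) z‖ ^ p) =
          (‖c‖ ^ p) • (fun z : ℂ => ‖zeroExt f z‖ ^ p) := by
        funext z
        rw [zeroExt_smul]
        simp [Real.mul_rpow (norm_nonneg _) (norm_nonneg _)]
      rw [hpMean, h, Real.circleAverage_smul, smul_eq_mul]
      exact mul_le_mul_of_nonneg_left (hC r hr) (by positivity)

/-! ### The operators -/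

/-- Multiplication `f ↦ Ψ f`. -/
noncomputable def mulOp (Ψ : 𝔻 → ℂ) : Module.End ℂ (𝔻 → ℂ) := LinearMap.mulLeft ℂ Ψ

/-- Composition `f ↦ f ∘ φ`. -/
noncomputable def compOp (φ : DiscAut) : Module.End ℂ (𝔻 → ℂ) := LinearMap.funLeft ℂ ℂ φ.map

/-- The weight `(conj λ * φ')^(1/p)`, with the principal branch of the power. -/
noncomputable def weight (p : ℝ) (φ : DiscAut) (z : 𝔻) : ℂ :=
  ((starRingEnd ℂ) (φ.lam : ℂ) * deriv φ.eval z) ^ (((1 / p : ℝ)) : ℂ)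

/-- `U_φ f = (conj λ * φ')^(1/p) * (f ∘ φ)`. -/
noncomputable def U (p : ℝ) (φ : DiscAut) : Module.End ℂ (𝔻 → ℂ) :=
  mulOp (weight p φ) * compOp φ

/-- The linear operator `S` maps `H^p` into `H^p` isometrically. -/
def IsHpIsometry (p : ℝ) (hp : 1 ≤ p) (S : Module.End ℂ (𝔻 → ℂ)) : Prop :=
  ∀ f ∈ Hp p hp, S f ∈ Hp p hp ∧ hpNorm p (S f) = hpNorm p f

/-- The image `S H^p` has infinite codimension in `H^p`. -/
def HasInfiniteCodim (p : ℝ) (hp : 1 ≤ p) (S : Module.End ℂ (𝔻 → ℂ)) : Prop :=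
  ¬ FiniteDimensional ℂ (Hp p hp ⧸ ((Hp p hp).map S).submoduleOf (Hp p hp))

/-! ### Infinite Blaschke products -/

/-- `Ψ` is an infinite Blaschke product: a locally uniformly convergent product of infinitely many
disc automorphisms (each carrying its own unimodular factor) whose zeros `aₖ` satisfy the Blaschke
condition `∑ (1 - |aₖ|) < ∞`. -/
def IsInfiniteBlaschkeProduct (Ψ : 𝔻 → ℂ) : Prop :=
  ∃ b : ℕ → DiscAut, Summable (fun k => 1 - ‖((b k).a : ℂ)‖) ∧
    TendstoLocallyUniformly (fun (n : ℕ) (z : 𝔻) => ∏ k ∈ Finset.range n, (b k).eval z) Ψ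
      Filter.atTop

end HardyIsometry

/-! Isometry. On the circle the weight of `U` has `p`-th power modulus equal to the Poisson kernel
at `a`, which is the Jacobian of `φ`; a change of variables (`DiscAut.circleAverage_comp`) therefore
preserves `p`-th means. Boundary values of `H^p` functions are avoided by dilating, using that means
increase with the radius (`circleAverage_rpow_norm_mono`), and letting the dilation tend to one; the
inverse automorphism supplies the opposite inequality. Multiplication by `Ψ` does not increase the
norm because `|Ψ| ≤ 1`. It does not decrease it either: each factor has modulus close to one near
the circle, and the tails of the product tend to one.

Codimension. Every function in the range vanishes at the infinitely many zeros of `Ψ`.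

Intersection. Since `U` maps `H^p` onto itself, `S^n H^p` consists of the multiples of `∏_{j<n} Ψ ∘
φ^j` (`mulOp_mul_U_pow_apply`). The Cayley transform at a boundary fixed point conjugates `φ` to `z
↦ A z + i B`, so forward orbits satisfy the Blaschke condition
(`DiscAut.summable_one_sub_norm_iterate`). For (i), zeros of `Ψ` are put far out on the forward
orbits of points `c k → 0`; a function in every range vanishes at all `c k`, hence identically. For
(ii), zeros are put sparsely on the backward orbit of `0`; then `|Ψ|` is so close to one on the
forward orbit that the infinite product of the `Ψ ∘ φ^j`, corrected by unimodular constants,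
converges to a nonzero function lying in every range. -/

namespace HardyIsometry

open Filter Topology Real

/-! ### Disc automorphisms -/

namespace DiscAut

variable (φ : DiscAut)

theorem norm_conj_mul_lt {a z : ℂ} (ha : ‖a‖ < 1) (hz : ‖z‖ ≤ 1) :
    ‖(starRingEnd ℂ) a * z‖ < 1 := by
  rw [norm_mul, RCLike.norm_conj]
  nlinarith [norm_nonneg z, norm_nonneg a]

theorem one_sub_conj_mul_ne_zero {a z : ℂ} (ha : ‖a‖ < 1) (hz : ‖z‖ ≤ 1) :
    1 - (starRingEnd ℂ) a * z ≠ 0 := by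
  intro h
  have := norm_conj_mul_lt ha hz
  rw [← sub_eq_zero.1 h, norm_one] at this
  exact lt_irrefl _ this

theorem den_ne_zero {z : ℂ} (hz : ‖z‖ ≤ 1) : 1 - (starRingEnd ℂ) (φ.a : ℂ) * z ≠ 0 :=
  one_sub_conj_mul_ne_zero φ.a.norm_lt_one hz

/-- Source of both the invariance of the disc and circle under `φ` and the Poisson kernel formula
for `|φ'|` on the circle. -/
theorem sq_norm_one_sub_conj_mul_sub (a z : ℂ) :
    ‖1 - (starRingEnd ℂ) a * z‖ ^ 2 - ‖z - a‖ ^ 2 = (1 - ‖a‖ ^ 2) * (1 - ‖z‖ ^ 2) := by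
  simp only [← Complex.normSq_eq_norm_sq, Complex.normSq_apply, Complex.sub_re, Complex.sub_im,
    Complex.one_re, Complex.one_im, Complex.mul_re, Complex.mul_im, Complex.conj_re,
    Complex.conj_im]
  ring

theorem norm_eval (z : ℂ) :
    ‖φ.eval z‖ = ‖z - φ.a‖ / ‖1 - (starRingEnd ℂ) (φ.a : ℂ) * z‖ := by
  rw [eval, norm_div, norm_mul, Circle.norm_coe, one_mul]

theorem one_sub_sq_norm_eval {z : ℂ} (hz : ‖z‖ ≤ 1) :
    1 - ‖φ.eval z‖ ^ 2 =
      (1 - ‖(φ.a : ℂ)‖ ^ 2) * (1 - ‖z‖ ^ 2) / ‖1 - (starRingEnd ℂ) (φ.a : ℂ) * z‖ ^ 2 := by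
  have h := norm_pos_iff.2 (φ.den_ne_zero hz)
  rw [norm_eval, ← sq_norm_one_sub_conj_mul_sub, sub_div, div_self (by positivity), div_pow]

theorem sq_norm_a_lt : ‖(φ.a : ℂ)‖ ^ 2 < 1 := φ.a.sq_norm_lt_one

theorem norm_eval_le_one {z : ℂ} (hz : ‖z‖ ≤ 1) : ‖φ.eval z‖ ≤ 1 := by
  have h := φ.one_sub_sq_norm_eval hz
  have h1 : 0 ≤ 1 - ‖φ.eval z‖ ^ 2 := by
    rw [h]
    have := φ.sq_norm_a_lt
    have : ‖z‖ ^ 2 ≤ 1 := pow_le_one₀ (norm_nonneg _) hz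
    exact div_nonneg (mul_nonneg (by linarith) (by linarith)) (by positivity)
  nlinarith [norm_nonneg (φ.eval z)]

theorem norm_eval_eq_one {z : ℂ} (hz : ‖z‖ = 1) : ‖φ.eval z‖ = 1 := by
  have h := φ.one_sub_sq_norm_eval hz.le
  rw [hz] at h
  have : ‖φ.eval z‖ ^ 2 = 1 := by
    have h0 : 1 - ‖φ.eval z‖ ^ 2 = 0 := by rw [h]; simp
    linarith
  exact (pow_eq_one_iff_of_nonneg (norm_nonneg _) two_ne_zero).1 this

theorem hasDerivAt_eval {z : ℂ} (hz : ‖z‖ ≤ 1) :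
    HasDerivAt φ.eval ((φ.lam : ℂ) * (1 - (‖(φ.a : ℂ)‖ : ℂ) ^ 2) /
      (1 - (starRingEnd ℂ) (φ.a : ℂ) * z) ^ 2) z := by
  have hd := φ.den_ne_zero hz
  have h1 : HasDerivAt (fun z : ℂ => (φ.lam : ℂ) * (z - (φ.a : ℂ))) (φ.lam : ℂ) z := by
    simpa using ((hasDerivAt_id z).sub_const (φ.a : ℂ)).const_mul (φ.lam : ℂ)
  have h2 : HasDerivAt (fun z : ℂ => 1 - (starRingEnd ℂ) (φ.a : ℂ) * z)
      (-(starRingEnd ℂ) (φ.a : ℂ)) z := by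
    simpa using ((hasDerivAt_id z).const_mul ((starRingEnd ℂ) (φ.a : ℂ))).const_sub 1
  refine (h1.div h2 hd).congr_deriv ?_
  congr 1
  rw [← Complex.conj_mul']
  ring

theorem differentiableOn_eval : DifferentiableOn ℂ φ.eval (Metric.closedBall 0 1) := fun z hz =>
  (φ.hasDerivAt_eval (by simpa using hz)).differentiableAt.differentiableWithinAt

theorem eval_sub_eval {z w : ℂ} (hz : ‖z‖ ≤ 1) (hw : ‖w‖ ≤ 1) :
    φ.eval z - φ.eval w = (φ.lam : ℂ) * (1 - (‖(φ.a : ℂ)‖ : ℂ) ^ 2) * (z - w) /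
      ((1 - (starRingEnd ℂ) (φ.a : ℂ) * z) * (1 - (starRingEnd ℂ) (φ.a : ℂ) * w)) := by
  have h1 := φ.den_ne_zero hz
  have h2 := φ.den_ne_zero hw
  rw [eval, eval, ← Complex.conj_mul', div_sub_div _ _ h1 h2]
  congr 1
  ring

@[simp] theorem coe_map (z : 𝔻) : ((φ.map z : 𝔻) : ℂ) = φ.eval z := rfl

/-- The inverse automorphism. -/
noncomputable def inv : DiscAut where
  a := -(φ.lam • φ.a)
  lam := φ.lam⁻¹

theorem inv_a : ((φ.inv.a : 𝔻) : ℂ) = -((φ.lam : ℂ) * φ.a) := by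
  simp [inv]

theorem inv_lam : (φ.inv.lam : ℂ) = (starRingEnd ℂ) (φ.lam : ℂ) := by
  rw [inv, Circle.coe_inv_eq_conj]

theorem conj_lam_mul_lam : (starRingEnd ℂ) (φ.lam : ℂ) * (φ.lam : ℂ) = 1 := by
  rw [Complex.conj_mul', Circle.norm_coe]; simp

theorem one_sub_sq_ne_zero : (1 : ℂ) - (starRingEnd ℂ) (φ.a : ℂ) * φ.a ≠ 0 :=
  φ.den_ne_zero φ.a.norm_lt_one.le

theorem inv_eval_eval {z : ℂ} (hz : ‖z‖ ≤ 1) : φ.inv.eval (φ.eval z) = z := by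
  have h1 := φ.den_ne_zero hz
  have h2 := φ.one_sub_sq_ne_zero
  have h3 := φ.conj_lam_mul_lam
  have h4 : 1 + (starRingEnd ℂ) (φ.a : ℂ) * (starRingEnd ℂ) (φ.lam : ℂ) * φ.eval z =
      (1 - (starRingEnd ℂ) (φ.a : ℂ) * φ.a) / (1 - (starRingEnd ℂ) (φ.a : ℂ) * z) := by
    rw [eval, eq_div_iff h1, add_mul, mul_assoc, div_mul_cancel₀ _ h1]
    linear_combination (starRingEnd ℂ) (φ.a : ℂ) * (z - φ.a) * h3
  rw [eval, inv_lam, inv_a, map_neg, map_mul]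
  have h5 : 1 - -((starRingEnd ℂ) (φ.lam : ℂ) * (starRingEnd ℂ) (φ.a : ℂ)) * φ.eval z =
      (1 - (starRingEnd ℂ) (φ.a : ℂ) * φ.a) / (1 - (starRingEnd ℂ) (φ.a : ℂ) * z) := by
    rw [← h4]; ring
  rw [h5, div_eq_iff (div_ne_zero h2 h1), eval, sub_neg_eq_add, mul_div_assoc', eq_div_iff h1,
    mul_assoc, add_mul, div_mul_cancel₀ _ h1]
  linear_combination ((z - φ.a) + φ.a * (1 - (starRingEnd ℂ) (φ.a : ℂ) * z)) * h3

theorem inv_map_map (z : 𝔻) : φ.inv.map (φ.map z) = z := by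
  rw [← Complex.UnitDisc.coe_inj]
  exact φ.inv_eval_eval z.norm_lt_one.le

theorem inv_inv : φ.inv.inv = φ := by
  cases φ with
  | mk a lam =>
    simp only [inv, _root_.inv_inv]
    congr 1
    rw [← Complex.UnitDisc.coe_inj]
    simp

theorem map_inv_map (z : 𝔻) : φ.map (φ.inv.map z) = z := by
  simpa [inv_inv] using φ.inv.inv_map_map z

/-- The automorphism `z ↦ (z - a) / (1 - conj a * z)`. -/
noncomputable def ofZero (a : 𝔻) : DiscAut := ⟨a, 1⟩

theorem eval_ofZero (a : 𝔻) (z : ℂ) :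
    (ofZero a).eval z = (z - a) / (1 - (starRingEnd ℂ) (a : ℂ) * z) := by
  simp [eval, ofZero]

theorem norm_eval_eq_ofZero (z : ℂ) : ‖φ.eval z‖ = ‖(ofZero φ.a).eval z‖ := by
  rw [norm_eval, norm_eval]; rfl

/-- The pseudo-hyperbolic distance is invariant under automorphisms. -/
theorem norm_ofZero_map (z w : 𝔻) :
    ‖(ofZero (φ.map w)).eval (φ.map z)‖ = ‖(ofZero w).eval z‖ := by
  have hz := z.norm_lt_one.le
  have hw := w.norm_lt_one.le
  have h1 := φ.den_ne_zero hz
  have h2 := φ.den_ne_zero hw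
  have h3 := one_sub_conj_mul_ne_zero w.norm_lt_one hz
  have hA : (1 : ℂ) - (‖(φ.a : ℂ)‖ : ℂ) ^ 2 ≠ 0 := by
    rw [← Complex.conj_mul']; exact φ.one_sub_sq_ne_zero
  have h2' : 1 - (φ.a : ℂ) * (starRingEnd ℂ) (w : ℂ) ≠ 0 := by
    have := (map_ne_zero (starRingEnd ℂ)).2 h2
    simpa using this
  have h4 : 1 - (starRingEnd ℂ) (φ.eval w) * φ.eval z =
      (1 - (‖(φ.a : ℂ)‖ : ℂ) ^ 2) * (1 - (starRingEnd ℂ) (w : ℂ) * z) /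
        ((1 - (φ.a : ℂ) * (starRingEnd ℂ) (w : ℂ)) * (1 - (starRingEnd ℂ) (φ.a : ℂ) * z)) := by
    rw [eval, eval, ← Complex.conj_mul']
    simp only [map_div₀, map_mul, map_sub, map_one, Complex.conj_conj]
    rw [div_mul_div_comm, sub_eq_iff_eq_add, ← add_div, eq_div_iff (mul_ne_zero h2' h1)]
    linear_combination (-((starRingEnd ℂ) (w : ℂ) - (starRingEnd ℂ) (φ.a : ℂ)) *
      ((z : ℂ) - φ.a)) * φ.conj_lam_mul_lam
  have h5 : ‖1 - (φ.a : ℂ) * (starRingEnd ℂ) (w : ℂ)‖ =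
      ‖1 - (starRingEnd ℂ) (φ.a : ℂ) * w‖ := by
    rw [← RCLike.norm_conj]; simp
  rw [eval_ofZero, eval_ofZero, coe_map, coe_map, φ.eval_sub_eval hz hw, h4]
  simp only [norm_div, norm_mul, h5, Circle.norm_coe, one_mul]
  have h1 := norm_ne_zero_iff.2 h1
  have h2 := norm_ne_zero_iff.2 h2
  have h3 := norm_ne_zero_iff.2 h3
  have hA := norm_ne_zero_iff.2 hA
  generalize ‖1 - (starRingEnd ℂ) (φ.a : ℂ) * z‖ = d1 at *
  generalize ‖1 - (starRingEnd ℂ) (φ.a : ℂ) * w‖ = d2 at *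
  generalize ‖1 - (starRingEnd ℂ) (w : ℂ) * z‖ = d3 at *
  field_simp

/-- Moving both points by `φ^m` turns the pseudo-hyperbolic distance from `φ^{-m}(0)` to `z` into
that from `0` to `φ^m(z)`. Factors with zeros on the backward orbit can thus be evaluated on the
forward orbit. -/
theorem norm_ofZero_iterate_inv (m : ℕ) (z : 𝔻) :
    ‖(ofZero (φ.inv.map^[m] 0)).eval z‖ = ‖((φ.map^[m] z : 𝔻) : ℂ)‖ := by
  induction m generalizing z with
  | zero => simp [eval_ofZero]
  | succ m ih =>
    rw [Function.iterate_succ_apply', Function.iterate_succ_apply, ← ih, ← φ.norm_ofZero_map,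
      map_inv_map]

/-! ### Dynamics near a boundary fixed point -/

/-- The Cayley transform sending the boundary point `w` to infinity. -/
noncomputable def cayley (w z : ℂ) : ℂ := (w + z) / (w - z)

theorem cayley_add_one {w z : ℂ} (h : w ≠ z) : cayley w z + 1 = 2 * w / (w - z) := by
  have : w - z ≠ 0 := sub_ne_zero.2 h
  rw [cayley]; field_simp; ring

theorem re_cayley {w z : ℂ} (hw : ‖w‖ = 1) :
    (cayley w z).re = (1 - ‖z‖ ^ 2) / ‖w - z‖ ^ 2 := by
  have h1 : ‖w‖ ^ 2 = 1 := by rw [hw]; norm_num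
  rw [cayley, Complex.div_re, ← Complex.normSq_eq_norm_sq (w - z), ← add_div, ← h1,
    ← Complex.normSq_eq_norm_sq, ← Complex.normSq_eq_norm_sq, Complex.normSq_apply w,
    Complex.normSq_apply z]
  congr 1
  simp
  ring

theorem one_sub_sq_norm_eq {w z : ℂ} (hw : ‖w‖ = 1) (h : w ≠ z) :
    1 - ‖z‖ ^ 2 = 4 * (cayley w z).re / ‖cayley w z + 1‖ ^ 2 := by
  have : 0 < ‖w - z‖ := norm_pos_iff.2 (sub_ne_zero.2 h)
  rw [cayley_add_one h, re_cayley hw, norm_div, norm_mul, hw]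
  norm_num
  field_simp
  norm_num

theorem ne_coe_of_norm_eq_one {w : ℂ} (hw : ‖w‖ = 1) (z : 𝔻) : w ≠ z := fun h =>
  z.norm_ne_one (h ▸ hw)

/-- An automorphism of the right half-plane fixing infinity is affine. Here `A` is `1 / |φ'(w)|`. -/
theorem cayley_map {w : ℂ} (hw : ‖w‖ = 1) (hfix : φ.eval w = w) :
    ∃ A B : ℝ, 0 < A ∧ ∀ z : 𝔻,
      cayley w (φ.map z) = A * cayley w z + B * Complex.I := by
  have hwa : w - φ.a ≠ 0 := sub_ne_zero.2 (ne_coe_of_norm_eq_one hw _)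
  have hww : (starRingEnd ℂ) w * w = 1 := by rw [Complex.conj_mul', hw]; simp
  have hA : (1 : ℂ) - (‖(φ.a : ℂ)‖ : ℂ) ^ 2 ≠ 0 := by
    rw [← Complex.conj_mul']; exact φ.one_sub_sq_ne_zero
  have hA' : 0 < 1 - ‖(φ.a : ℂ)‖ ^ 2 := by linarith [φ.sq_norm_a_lt]
  have hd := φ.den_ne_zero hw.le
  have hlam : (φ.lam : ℂ) * (w - φ.a) = w * (1 - (starRingEnd ℂ) (φ.a : ℂ) * w) := by
    rwa [eval, div_eq_iff hd] at hfix
  have hw0 : w ≠ 0 := by rintro rfl; simp at hw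
  have hl0 : (φ.lam : ℂ) ≠ 0 := Circle.coe_ne_zero _
  refine ⟨‖w - φ.a‖ ^ 2 / (1 - ‖(φ.a : ℂ)‖ ^ 2),
    2 * ((starRingEnd ℂ) (φ.a : ℂ) * w).im / (1 - ‖(φ.a : ℂ)‖ ^ 2), ?_, fun z => ?_⟩
  · have := norm_pos_iff.2 hwa
    positivity
  have hz := z.norm_lt_one.le
  have hdz := φ.den_ne_zero hz
  have hwz : w - z ≠ 0 := sub_ne_zero.2 (ne_coe_of_norm_eq_one hw _)
  have h1 : w - φ.eval z = (1 - (‖(φ.a : ℂ)‖ : ℂ) ^ 2) * (w * (w - z)) /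
      ((w - φ.a) * (1 - (starRingEnd ℂ) (φ.a : ℂ) * z)) := by
    conv_lhs => rw [← hfix]
    rw [φ.eval_sub_eval hw.le hz, div_eq_div_iff (mul_ne_zero hd hdz) (mul_ne_zero hwa hdz)]
    linear_combination (1 - (‖(φ.a : ℂ)‖ : ℂ) ^ 2) * (w - z) *
      (1 - (starRingEnd ℂ) (φ.a : ℂ) * z) * hlam
  have h2 : cayley w (φ.map z) + 1 =
      2 * (w - φ.a) * (1 - (starRingEnd ℂ) (φ.a : ℂ) * z) /
        ((1 - (‖(φ.a : ℂ)‖ : ℂ) ^ 2) * (w - z)) := by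
    rw [cayley_add_one (ne_coe_of_norm_eq_one hw _), coe_map, h1]
    field_simp
  have him : (2 * ((starRingEnd ℂ) (φ.a : ℂ) * w).im : ℂ) * Complex.I =
      (starRingEnd ℂ) (φ.a : ℂ) * w - φ.a * (starRingEnd ℂ) w := by
    rw [show φ.a * (starRingEnd ℂ) w = (starRingEnd ℂ) ((starRingEnd ℂ) (φ.a : ℂ) * w) by simp,
      Complex.sub_conj]
    push_cast; ring
  have hn : (‖w - φ.a‖ : ℂ) ^ 2 = (starRingEnd ℂ) (w - φ.a) * (w - φ.a) :=
    (Complex.conj_mul' _).symm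
  rw [eq_sub_of_add_eq h2, cayley]
  push_cast
  rw [div_mul_eq_mul_div _ _ Complex.I, him, hn]
  have hn2 := Complex.conj_mul' (φ.a : ℂ)
  generalize (‖(φ.a : ℂ)‖ : ℂ) ^ 2 = N at *
  simp only [map_sub]
  field_simp
  rw [← hn2]
  generalize (starRingEnd ℂ) w = w' at *
  generalize (starRingEnd ℂ) (φ.a : ℂ) = a' at *
  linear_combination (2 * φ.a - z - w) * hww

end DiscAut

/-! ### Orbits and the Blaschke condition -/

namespace DiscAut

variable (φ : DiscAut)

theorem cayley_injOn {w : ℂ} (hw : ‖w‖ = 1) {z z' : 𝔻} (h : cayley w z = cayley w z') :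
    z = z' := by
  have hw0 : w ≠ 0 := by rintro rfl; simp at hw
  have h1 := sub_ne_zero.2 (ne_coe_of_norm_eq_one hw z)
  have h2 := sub_ne_zero.2 (ne_coe_of_norm_eq_one hw z')
  rw [cayley, cayley, div_eq_div_iff h1 h2] at h
  rw [← Complex.UnitDisc.coe_inj]
  have : 2 * w * ((z : ℂ) - z') = 0 := by linear_combination h
  simpa [hw0, sub_eq_zero] using this

theorem re_cayley_pos {w : ℂ} (hw : ‖w‖ = 1) (z : 𝔻) : 0 < (cayley w z).re := by
  rw [re_cayley hw]
  have := norm_pos_iff.2 (sub_ne_zero.2 (ne_coe_of_norm_eq_one hw z))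
  have := z.sq_norm_lt_one
  exact div_pos (by linarith) (by positivity)

/-- The distance of a point to the circle, bounded through its Cayley transform. -/
theorem one_sub_norm_le {w : ℂ} (hw : ‖w‖ = 1) (z : 𝔻) :
    1 - ‖(z : ℂ)‖ ≤ 4 * (cayley w z).re / ‖cayley w z + 1‖ ^ 2 := by
  rw [← one_sub_sq_norm_eq hw (ne_coe_of_norm_eq_one hw z)]
  nlinarith [z.norm_lt_one, norm_nonneg (z : ℂ)]

/-- This bound and the next two serve half-plane orbits whose real part grows, whose real part tends
to zero, and whose imaginary part is unbounded, respectively. -/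
theorem one_sub_norm_le_div_re {w : ℂ} (hw : ‖w‖ = 1) (z : 𝔻) :
    1 - ‖(z : ℂ)‖ ≤ 4 * (cayley w z).re⁻¹ := by
  have hx := re_cayley_pos hw z
  refine (one_sub_norm_le hw z).trans ?_
  have h1 : (cayley w z).re ≤ ‖cayley w z + 1‖ := by
    have := Complex.re_le_norm (cayley w z + 1)
    simp at this
    linarith
  calc _ ≤ 4 * (cayley w z).re / (cayley w z).re ^ 2 := by gcongr
    _ = _ := by field_simp

theorem one_sub_norm_le_re {w : ℂ} (hw : ‖w‖ = 1) (z : 𝔻) :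
    1 - ‖(z : ℂ)‖ ≤ 4 * (cayley w z).re := by
  have hx := re_cayley_pos hw z
  refine (one_sub_norm_le hw z).trans ?_
  have h1 : 1 ≤ ‖cayley w z + 1‖ := by
    have := Complex.re_le_norm (cayley w z + 1)
    simp at this
    linarith
  exact div_le_self (by positivity) (one_le_pow₀ h1)

theorem one_sub_norm_le_div_im {w : ℂ} (hw : ‖w‖ = 1) (z : 𝔻) (him : (cayley w z).im ≠ 0) :
    1 - ‖(z : ℂ)‖ ≤ 4 * (cayley w z).re / (cayley w z).im ^ 2 := by
  have hx := re_cayley_pos hw z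
  refine (one_sub_norm_le hw z).trans ?_
  have h1 : (cayley w z).im ^ 2 ≤ ‖cayley w z + 1‖ ^ 2 := by
    have := Complex.abs_im_le_norm (cayley w z + 1)
    simp only [Complex.add_im, Complex.one_im, add_zero] at this
    rw [← sq_abs]
    gcongr
  have : 0 < (cayley w z).im ^ 2 := by positivity
  gcongr

/-- The orbits of a non-trivial automorphism with a fixed point on the circle satisfy the Blaschke
condition. -/
theorem summable_one_sub_norm_iterate {w : ℂ} (hw : ‖w‖ = 1) (hfix : φ.eval w = w)
    (hne : ∃ z : 𝔻, φ.map z ≠ z) (c : 𝔻) :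
    Summable fun n : ℕ => 1 - ‖((φ.map^[n] c : 𝔻) : ℂ)‖ := by
  obtain ⟨A, B, hA, hAB⟩ := φ.cayley_map hw hfix
  have hnn : ∀ n : ℕ, 0 ≤ 1 - ‖((φ.map^[n] c : 𝔻) : ℂ)‖ := fun n => by
    linarith [(φ.map^[n] c).norm_lt_one]
  have hx := re_cayley_pos hw c
  have hre : ∀ n : ℕ, (cayley w (φ.map^[n] c : 𝔻)).re = A ^ n * (cayley w c).re := by
    intro n
    induction n with
    | zero => simp
    | succ n ih =>
      rw [Function.iterate_succ_apply', hAB, pow_succ', mul_assoc, ← ih]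
      simp
  -- Real parts form a geometric progression of ratio `A`. For `A = 1` they are constant, and
  -- non-triviality forces a vertical drift `B ≠ 0`, giving decay of order `n⁻²`.
  rcases lt_trichotomy A 1 with h1 | h1 | h1
  · refine Summable.of_nonneg_of_le hnn (fun n => one_sub_norm_le_re hw _) ?_
    simp only [hre]
    exact ((summable_geometric_of_lt_one hA.le h1).mul_right _).mul_left 4
  · subst h1
    have hB : B ≠ 0 := by
      rintro rfl
      obtain ⟨z, hz⟩ := hne
      exact hz (cayley_injOn hw (by rw [hAB]; simp))
    have him : ∀ n : ℕ, (cayley w (φ.map^[n] c : 𝔻)).im = B * (n + (cayley w c).im / B) := by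
      intro n
      induction n with
      | zero => simp; field_simp
      | succ n ih =>
        rw [Function.iterate_succ_apply', hAB]
        simp only [Complex.ofReal_one, one_mul, Complex.add_im, ih]
        simp
        ring
    have hs := (Real.summable_one_div_nat_add_rpow ((cayley w c).im / B) 2).2 (by norm_num)
    refine Summable.of_norm_bounded_eventually_nat
      (hs.mul_left (4 * (cayley w c).re / B ^ 2)) ?_
    have hev : ∀ᶠ n : ℕ in atTop, -((cayley w c).im / B) < n :=
      tendsto_natCast_atTop_atTop.eventually_gt_atTop _
    filter_upwards [hev] with n hn
    have h0 : (n : ℝ) + (cayley w c).im / B ≠ 0 := by linarith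
    rw [Real.norm_of_nonneg (hnn n)]
    refine (one_sub_norm_le_div_im hw _ (by rw [him]; exact mul_ne_zero hB h0)).trans_eq ?_
    rw [hre, him, Real.rpow_two, sq_abs]
    field_simp
    simp
  · refine Summable.of_nonneg_of_le hnn (fun n => one_sub_norm_le_div_re hw _) ?_
    simp only [hre, mul_inv, ← inv_pow]
    exact ((summable_geometric_of_lt_one (by positivity) (inv_lt_one_of_one_lt₀ h1)).mul_right
      _).mul_left 4

/-- The only common feature of the two types that the dynamics needs. -/
theorem exists_boundary_fixed_point (hφ : φ.IsParabolic ∨ φ.IsHyperbolic) :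
    (∃ w : ℂ, ‖w‖ = 1 ∧ φ.eval w = w) ∧ ∃ z : 𝔻, φ.map z ≠ z := by
  rcases hφ with ⟨w, hw, h⟩ | ⟨hne, w, -, -, hw, -, hfix, -⟩
  · refine ⟨⟨w, hw, (h w hw.le).2 rfl⟩, 0, fun h0 => ?_⟩
    have := (h 0 (by simp)).1 (by simpa [← Complex.UnitDisc.coe_inj] using h0)
    rw [← this] at hw
    simp at hw
  · exact ⟨⟨w, hw, hfix⟩, hne⟩

end DiscAut

/-! ### Products of bounded analytic functions -/

/-- Borel–Carathéodory for `h - x`, whose real part is at most `1 - x`. It upgrades summability of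
the defects at the origin to locally uniform convergence of products. -/
theorem norm_sub_one_le_of_norm_le_one {h : ℂ → ℂ} (hd : DifferentiableOn ℂ h (Metric.ball 0 1))
    (hb : ∀ z ∈ Metric.ball (0 : ℂ) 1, ‖h z‖ ≤ 1) {x : ℝ} (h0 : h 0 = x) {z : ℂ}
    (hz : ‖z‖ < 1) : ‖h z - 1‖ ≤ (1 - x) * ((1 + ‖z‖) / (1 - ‖z‖)) := by
  have hx : x ≤ 1 := by
    have := hb 0 (by simp)
    rw [h0, Complex.norm_real] at this
    exact (le_abs_self x).trans this
  have hz' : 0 < 1 - ‖z‖ := by linarith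
  -- The strict inequality keeps `M` positive even if `x = 1`; afterwards `M` decreases to `1 - x`.
  have key : ∀ M, 1 - x < M → ‖h z - x‖ ≤ 2 * M * ‖z‖ / (1 - ‖z‖) := by
    intro M hM
    refine Complex.borelCaratheodory_zero (f := fun z => h z - x) (M := M) (by linarith)
      (hd.sub_const _) ?_ one_pos (by simpa using hz) (by simp [h0])
    intro y hy
    have := (Complex.re_le_norm (h y)).trans (hb y hy)
    simp only [Set.mem_ofPred_eq, Complex.sub_re, Complex.ofReal_re]
    linarith
  have key' : ‖h z - x‖ ≤ 2 * (1 - x) * ‖z‖ / (1 - ‖z‖) := by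
    have hc : Continuous fun M : ℝ => 2 * M * ‖z‖ / (1 - ‖z‖) := by fun_prop
    exact ge_of_tendsto ((hc.tendsto (1 - x)).mono_left nhdsWithin_le_nhds)
      (eventually_nhdsWithin_of_forall (s := Set.Ioi (1 - x)) key)
  calc ‖h z - 1‖ = ‖(h z - x) + (x - 1)‖ := by ring_nf
    _ ≤ ‖h z - x‖ + ‖(x : ℂ) - 1‖ := norm_add_le _ _
    _ = ‖h z - x‖ + (1 - x) := by
      rw [← Complex.ofReal_one, ← Complex.ofReal_sub, Complex.norm_real, Real.norm_eq_abs,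
        abs_sub_comm, abs_of_nonneg (by linarith)]
    _ ≤ 2 * (1 - x) * ‖z‖ / (1 - ‖z‖) + (1 - x) := by gcongr
    _ = _ := by field_simp; ring

theorem exists_circle_mul_eq_norm (c : ℂ) : ∃ u : Circle, (u : ℂ) * c = (‖c‖ : ℂ) := by
  refine ⟨Circle.exp (-c.arg), ?_⟩
  conv_lhs => rw [← Complex.norm_mul_exp_arg_mul_I c]
  rw [Circle.coe_exp, mul_left_comm, ← Complex.exp_add]
  simp

/-- Infinite products of analytic functions bounded by one, each corrected by a unimodular
constant. The function `R n` is the tail product over the indices `≥ n`. -/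
theorem exists_product {h : ℕ → ℂ → ℂ} (hd : ∀ j, DifferentiableOn ℂ (h j) (Metric.ball 0 1))
    (hb : ∀ j, ∀ z ∈ Metric.ball (0 : ℂ) 1, ‖h j z‖ ≤ 1)
    (hs : Summable fun j => 1 - ‖h j 0‖) :
    ∃ (u : ℕ → Circle) (R : ℕ → ℂ → ℂ),
      (∀ n, DifferentiableOn ℂ (R n) (Metric.ball 0 1)) ∧
      (∀ n, ∀ z ∈ Metric.ball (0 : ℂ) 1, ‖R n z‖ ≤ 1) ∧
      (∀ n, ∀ z ∈ Metric.ball (0 : ℂ) 1, R n z = u n * h n z * R (n + 1) z) ∧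
      (∀ z ∈ Metric.ball (0 : ℂ) 1, Tendsto (fun n => R n z) atTop (𝓝 1)) ∧
      TendstoLocallyUniformlyOn (fun (n : ℕ) z => ∏ k ∈ Finset.range n, ((u k : ℂ) * h k z))
        (R 0) atTop (Metric.ball 0 1) := by
  -- Rotating each factor to be nonnegative at the origin makes its distance to one there equal to
  -- `1 - ‖h j 0‖`.
  choose u hu using fun j => exists_circle_mul_eq_norm (h j 0)
  set g : ℕ → ℂ → ℂ := fun j z => u j * h j z with hg
  have gd : ∀ j, DifferentiableOn ℂ (g j) (Metric.ball 0 1) := fun j => (hd j).const_mul _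
  have gb : ∀ j, ∀ z ∈ Metric.ball (0 : ℂ) 1, ‖g j z‖ ≤ 1 := fun j z hz => by
    simpa only [hg, norm_mul, Circle.norm_coe, one_mul] using hb j z hz
  have gest : ∀ j (z : ℂ), ‖z‖ < 1 →
      ‖g j z - 1‖ ≤ (1 - ‖h j 0‖) * ((1 + ‖z‖) / (1 - ‖z‖)) := fun j z hz =>
    norm_sub_one_le_of_norm_le_one (gd j) (gb j) (hu j) hz
  have gsum : ∀ z ∈ Metric.ball (0 : ℂ) 1, Summable fun j => ‖g j z - 1‖ := fun z hz =>
    Summable.of_nonneg_of_le (fun _ => norm_nonneg _) (fun j => gest j z (by simpa using hz))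
      (hs.mul_right _)
  have gmul : ∀ n, ∀ z ∈ Metric.ball (0 : ℂ) 1, Multipliable fun j => g (n + j) z := by
    intro n z hz
    have := multipliable_one_add_of_summable (f := fun j => g (n + j) z - 1)
      ((gsum z hz).comp_injective (add_right_injective n))
    simpa using this
  have hloc : ∀ n, HasProdLocallyUniformlyOn (fun j => g (n + j))
      (fun z => ∏' j, g (n + j) z) (Metric.ball 0 1) := by
    intro n
    refine hasProdLocallyUniformlyOn_of_of_forall_exists_nhds fun x hx => ?_
    obtain ⟨r, hr, hr1⟩ := exists_between (show ‖x‖ < 1 by simpa using hx)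
    refine ⟨Metric.closedBall 0 r, mem_nhdsWithin_of_mem_nhds
      (Metric.closedBall_mem_nhds_of_mem (by simpa using hr)), ?_⟩
    have hsub : Metric.closedBall (0 : ℂ) r ⊆ Metric.ball 0 1 :=
      Metric.closedBall_subset_ball hr1
    have := Summable.hasProdUniformlyOn_nat_one_add (f := fun j z => g (n + j) z - 1)
      (K := Metric.closedBall (0 : ℂ) r)
      (u := fun j => (1 - ‖h (n + j) 0‖) * ((1 + r) / (1 - r)))
      (isCompact_closedBall _ _)
      ((hs.comp_injective (add_right_injective n)).mul_right _)
      (Eventually.of_forall fun j z hz => ?_)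
      (fun j => ((gd _).continuousOn.mono hsub).sub continuousOn_const)
    · simpa using this
    · have hzr : ‖z‖ ≤ r := by simpa using hz
      refine (gest _ z (by linarith)).trans ?_
      have h1 : 0 ≤ 1 - ‖h (n + j) 0‖ := by
        have := hb (n + j) 0 (by simp)
        linarith
      have : 0 < 1 - r := by linarith
      have h2 : 0 ≤ 1 + r := by linarith [norm_nonneg z]
      gcongr
  refine ⟨u, fun n z => ∏' j, g (n + j) z, fun n => ?_, fun n z hz => ?_, fun n z hz => ?_,
    fun z hz => ?_, ?_⟩
  · refine TendstoLocallyUniformlyOn.differentiableOn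
      (hasProdLocallyUniformlyOn_iff_tendstoLocallyUniformlyOn.1 (hloc n))
      (Eventually.of_forall fun s => ?_) Metric.isOpen_ball
    exact DifferentiableOn.fun_finsetProd fun j _ => gd _
  · refine le_of_tendsto ((gmul n z hz).hasProd.norm) (Eventually.of_forall fun s => ?_)
    exact Finset.prod_le_one (fun _ _ => norm_nonneg _) fun j _ => gb _ z hz
  · have h3 : (fun j => g (n + (j + 1)) z) = fun j => g (n + 1 + j) z := by
      funext j
      rw [add_assoc, add_comm 1]
    have h2 := tprod_eq_zero_mul' (f := fun j => g (n + j) z) (h3 ▸ gmul (n + 1) z hz)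
    rwa [h3] at h2
  · have hS := gsum z hz
    have htail : Tendsto (fun n => Real.exp (∑' j, ‖g (j + n) z - 1‖) - 1) atTop (𝓝 0) := by
      have := ((Real.continuous_exp.tendsto 0).comp
        (tendsto_sum_nat_add fun j => ‖g j z - 1‖)).sub_const 1
      simpa using this
    rw [tendsto_iff_norm_sub_tendsto_zero]
    refine squeeze_zero (fun _ => norm_nonneg _) (fun n => ?_) htail
    refine le_of_tendsto ((gmul n z hz).hasProd.sub_const 1).norm (Eventually.of_forall fun s => ?_)
    have h1 := Finset.norm_prod_one_add_sub_one_le s fun j => g (n + j) z - 1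
    simp only [add_sub_cancel] at h1
    refine h1.trans (sub_le_sub_right (Real.exp_le_exp.2 ?_) 1)
    simp only [add_comm n]
    exact ((summable_nat_add_iff n).2 hS).sum_le_tsum s fun _ _ => norm_nonneg _
  · have := (hasProdLocallyUniformlyOn_iff_tendstoLocallyUniformlyOn.1 (hloc 0))
    intro v hv x hx
    obtain ⟨t, ht, ht'⟩ := this v hv x hx
    exact ⟨t, ht, by simpa using tendsto_finset_range.eventually ht'⟩

/-! ### Circle averages -/

/-- Convexity of `t ^ p` as a tangent line at `c`, from Bernoulli's inequality at `t / c - 1`. -/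
theorem tangent_le_rpow {p : ℝ} (hp : 1 ≤ p) {c t : ℝ} (hc : 0 < c) (ht : 0 ≤ t) :
    c ^ p + p * c ^ (p - 1) * (t - c) ≤ t ^ p := by
  have h := one_add_mul_self_le_rpow_one_add (s := t / c - 1) (p := p)
    (by have := div_nonneg ht hc.le; linarith) hp
  rw [add_sub_cancel, Real.div_rpow ht hc.le, le_div_iff₀ (by positivity)] at h
  refine le_trans (le_of_eq ?_) h
  rw [Real.rpow_sub_one hc.ne']
  field_simp

theorem continuousOn_poissonKernel {R : ℝ} {w : ℂ} (hw : w ∈ Metric.ball (0 : ℂ) R) :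
    ContinuousOn (poissonKernel 0 w) (Metric.sphere 0 R) := by
  simp only [funext (poissonKernel_def 0 w)]
  refine ContinuousOn.div (by fun_prop) (by fun_prop) fun z hz => ?_
  have : z ≠ w := by
    rintro rfl
    simp at hw hz
    linarith
  simpa [sub_eq_zero] using this

theorem poissonKernel_nonneg {R : ℝ} {w z : ℂ} (hw : w ∈ Metric.ball (0 : ℂ) R)
    (hz : z ∈ Metric.sphere (0 : ℂ) R) : 0 ≤ poissonKernel 0 w z := by
  simp only [Metric.mem_ball, dist_zero_right, mem_sphere_iff_norm, sub_zero] at hw hz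
  rw [poissonKernel_def, sub_zero, sub_zero, hz]
  have : ‖w‖ ^ 2 ≤ R ^ 2 := by gcongr
  exact div_nonneg (by linarith) (by positivity)

theorem circleAverage_poissonKernel {R : ℝ} {w : ℂ} (hw : w ∈ Metric.ball (0 : ℂ) R) :
    circleAverage (poissonKernel 0 w) 0 R = 1 := by
  have hR : 0 < R := Metric.pos_of_mem_ball hw
  have h := DiffContOnCl.circleAverage_poissonKernel_smul (f := fun _ => (1 : ℂ)) (c := 0)
    diffContOnCl_const hw
  have h2 := Complex.reCLM.circleAverage_comp_comm (f := poissonKernel 0 w • fun _ => (1 : ℂ))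
    (c := 0) (R := R)
    (((continuousOn_poissonKernel hw).smul continuousOn_const).circleIntegrable hR.le)
  rw [h] at h2
  have h3 : (Complex.reCLM ∘ (poissonKernel 0 w • fun _ => (1 : ℂ))) = poissonKernel 0 w := by
    funext z
    simp
  rw [h3] at h2
  simpa using h2

theorem continuousOn_sphere_of_diffContOnCl {g : ℂ → ℂ} {R : ℝ}
    (hg : DiffContOnCl ℂ g (Metric.ball 0 R)) (hR : 0 < R) :
    ContinuousOn g (Metric.sphere 0 R) :=
  hg.continuousOn.mono (by
    rw [closure_ball _ hR.ne']
    exact Metric.sphere_subset_closedBall)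

/-- The `p`-th power of the modulus of an analytic function is at most its Poisson integral. -/
theorem rpow_norm_le_circleAverage {p : ℝ} (hp : 1 ≤ p) {g : ℂ → ℂ} {R : ℝ} {w : ℂ}
    (hg : DiffContOnCl ℂ g (Metric.ball 0 R)) (hw : w ∈ Metric.ball (0 : ℂ) R) :
    ‖g w‖ ^ p ≤ circleAverage (fun z => poissonKernel 0 w z * ‖g z‖ ^ p) 0 R := by
  have hR : 0 < R := Metric.pos_of_mem_ball hw
  have hp0 : p ≠ 0 := by linarith
  have habs : |R| = R := abs_of_pos hR
  rcases eq_or_ne (g w) 0 with h0 | h0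
  · rw [h0, norm_zero, Real.zero_rpow hp0]
    refine circleAverage_nonneg_of_nonneg fun z hz => ?_
    rw [habs] at hz
    exact mul_nonneg (poissonKernel_nonneg hw hz) (by positivity)
  have hc : 0 < ‖g w‖ := norm_pos_iff.2 h0
  set c := ‖g w‖ with hcdef
  have hgs := continuousOn_sphere_of_diffContOnCl hg hR
  have hP := continuousOn_poissonKernel hw
  -- The analytic function `k0 + k1 g` equals `c ^ p` at `w`, and its real part is at most the
  -- tangent line at `c` evaluated at `|g|`, hence at most `|g| ^ p`. Its Poisson integral is exact.
  let k0 : ℂ := ((c ^ p - p * c ^ (p - 1) * c : ℝ) : ℂ)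
  let k1 : ℂ := ((p * c ^ (p - 1) : ℝ) : ℂ) * ((starRingEnd ℂ) (g w) / c)
  have hF : DiffContOnCl ℂ (fun z => k0 + k1 • g z) (Metric.ball 0 R) :=
    (hg.const_smul k1).const_add k0
  have hFs := continuousOn_sphere_of_diffContOnCl hF hR
  have h1 := hF.circleAverage_poissonKernel_smul hw
  have h2 := Complex.reCLM.circleAverage_comp_comm
    (f := poissonKernel 0 w • fun z => k0 + k1 • g z) (c := 0) (R := R)
    ((hP.smul hFs).circleIntegrable hR.le)
  have hval : k0 + k1 • g w = ((c ^ p : ℝ) : ℂ) := by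
    have hcc : (c : ℂ) ≠ 0 := by exact_mod_cast hc.ne'
    have h3 : (starRingEnd ℂ) (g w) / c * g w = c := by
      rw [div_mul_eq_mul_div, Complex.conj_mul', ← hcdef]
      field_simp
    simp only [k0, k1, smul_eq_mul, mul_assoc, h3]
    push_cast
    ring
  rw [h1, hval, Complex.reCLM_apply, Complex.ofReal_re] at h2
  rw [← h2]
  refine circleAverage_mono ?_ ?_ fun z hz => ?_
  · exact (Complex.continuous_re.comp_continuousOn (hP.smul hFs)).circleIntegrable hR.le
  · exact (hP.mul (hgs.norm.rpow_const fun _ _ => Or.inr (by linarith))).circleIntegrable hR.le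
  · rw [habs] at hz
    simp only [Function.comp_apply, Pi.smul_apply', Complex.reCLM_apply, Complex.real_smul,
      Complex.re_ofReal_mul]
    refine mul_le_mul_of_nonneg_left ?_ (poissonKernel_nonneg hw hz)
    have h4 : ((starRingEnd ℂ) (g w) / c * g z).re ≤ ‖g z‖ := by
      refine (Complex.re_le_norm _).trans ?_
      rw [norm_mul, norm_div, RCLike.norm_conj, Complex.norm_real, norm_norm, ← hcdef,
        div_self hc.ne', one_mul]
    refine le_trans ?_ (tangent_le_rpow hp hc (norm_nonneg (g z)))
    simp only [k0, k1, smul_eq_mul, mul_assoc, Complex.add_re, Complex.ofReal_re,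
      Complex.re_ofReal_mul]
    have h5 : 0 ≤ p * c ^ (p - 1) := by positivity
    have h6 := mul_le_mul_of_nonneg_left h4 h5
    simp only [mul_assoc] at h6
    linarith

/-- Both sides equal `R² + r² - 2Rr cos (s - t)`. This symmetry lets the Poisson kernel be
integrated over the inner angle after Fubini. -/
theorem norm_circleMap_sub_comm (r R s t : ℝ) :
    ‖circleMap 0 R t - circleMap 0 r s‖ ^ 2 = ‖circleMap 0 R s - circleMap 0 r t‖ ^ 2 := by
  simp only [← Complex.normSq_eq_norm_sq, Complex.normSq_apply, circleMap, zero_add,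
    Complex.exp_mul_I, ← Complex.ofReal_cos, ← Complex.ofReal_sin, Complex.sub_re,
    Complex.sub_im, Complex.add_re, Complex.add_im,
    Complex.ofReal_re, Complex.ofReal_im, Complex.I_re, Complex.I_im, Complex.mul_re,
    Complex.mul_im]
  linear_combination (R ^ 2 - r ^ 2) * (Real.sin_sq_add_cos_sq t) -
    (R ^ 2 - r ^ 2) * (Real.sin_sq_add_cos_sq s)

theorem poissonKernel_circleMap_comm (r R s t : ℝ) :
    poissonKernel 0 (circleMap 0 r s) (circleMap 0 R t) =
      poissonKernel 0 (circleMap 0 r t) (circleMap 0 R s) := by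
  simp only [poissonKernel_def, sub_zero, norm_circleMap_zero]
  rw [norm_circleMap_sub_comm]

/-- The `p`-th means of an analytic function increase with the radius. -/
theorem circleAverage_rpow_norm_mono {p : ℝ} (hp : 1 ≤ p) {g : ℂ → ℂ} {r R : ℝ} (hr : 0 < r)
    (hrR : r < R) (hg : DiffContOnCl ℂ g (Metric.ball 0 R)) :
    circleAverage (fun z => ‖g z‖ ^ p) 0 r ≤ circleAverage (fun z => ‖g z‖ ^ p) 0 R := by
  have hR : 0 < R := hr.trans hrR
  have hball : ∀ s, circleMap 0 r s ∈ Metric.ball (0 : ℂ) R := fun s => by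
    simpa [abs_of_pos hr] using hrR
  have hgs := continuousOn_sphere_of_diffContOnCl hg hR
  have hgR : Continuous fun t => ‖g (circleMap 0 R t)‖ ^ p := by
    refine Continuous.rpow_const ?_ fun _ => Or.inr (by linarith)
    exact (hgs.comp_continuous (continuous_circleMap 0 R) (circleMap_mem_sphere 0 hR.le)).norm
  have hgr : Continuous fun t => ‖g (circleMap 0 r t)‖ ^ p := by
    refine Continuous.rpow_const ?_ fun _ => Or.inr (by linarith)
    exact (hg.continuousOn.comp_continuous (continuous_circleMap 0 r)
      fun t => subset_closure (hball t)).norm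
  have hK : Continuous fun q : ℝ × ℝ =>
      poissonKernel 0 (circleMap 0 r q.1) (circleMap 0 R q.2) := by
    simp only [poissonKernel_def]
    refine Continuous.div (by fun_prop) (by fun_prop) fun q => ?_
    have h1 : circleMap 0 R q.2 ≠ circleMap 0 r q.1 := by
      intro h
      have := congrArg norm h
      simp only [norm_circleMap_zero, abs_of_pos hr, abs_of_pos hR] at this
      linarith
    simpa [sub_eq_zero] using h1
  have hΦ : Continuous fun q : ℝ × ℝ => poissonKernel 0 (circleMap 0 r q.1) (circleMap 0 R q.2) *
      ‖g (circleMap 0 R q.2)‖ ^ p := hK.mul (hgR.comp continuous_snd)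
  have h2π : (0 : ℝ) ≤ (2 * π)⁻¹ := by positivity
  -- The Poisson majorant is averaged over the inner circle; after exchanging the integrals the
  -- kernel averages to one.
  have hle : (∫ s in (0 : ℝ)..2 * π, ‖g (circleMap 0 r s)‖ ^ p) ≤
      ∫ s in (0 : ℝ)..2 * π, (2 * π)⁻¹ * ∫ t in (0 : ℝ)..2 * π,
        poissonKernel 0 (circleMap 0 r s) (circleMap 0 R t) * ‖g (circleMap 0 R t)‖ ^ p := by
    refine intervalIntegral.integral_mono_on (by positivity) (hgr.intervalIntegrable _ _) ?_
      fun s _ => ?_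
    · refine (Continuous.intervalIntegrable ?_ _ _)
      exact continuous_const.mul
        (intervalIntegral.continuous_parametric_intervalIntegral_of_continuous'
          (f := fun s t => poissonKernel 0 (circleMap 0 r s) (circleMap 0 R t) *
            ‖g (circleMap 0 R t)‖ ^ p) hΦ 0 (2 * π))
    · have := rpow_norm_le_circleAverage hp hg (hball s)
      rwa [circleAverage_def, smul_eq_mul] at this
  have hin : ∀ t, (2 * π)⁻¹ * ∫ s in (0 : ℝ)..2 * π,
      poissonKernel 0 (circleMap 0 r s) (circleMap 0 R t) * ‖g (circleMap 0 R t)‖ ^ p =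
        ‖g (circleMap 0 R t)‖ ^ p := by
    intro t
    rw [intervalIntegral.integral_mul_const, ← mul_assoc]
    have h1 := circleAverage_poissonKernel (hball t)
    rw [circleAverage_def, smul_eq_mul] at h1
    simp only [poissonKernel_circleMap_comm r R _ t]
    rw [h1, one_mul]
  have hint : MeasureTheory.IntegrableOn (Function.uncurry fun s t =>
      poissonKernel 0 (circleMap 0 r s) (circleMap 0 R t) * ‖g (circleMap 0 R t)‖ ^ p)
      (Set.uIoc 0 (2 * π) ×ˢ Set.uIoc 0 (2 * π)) :=
    (hΦ.continuousOn.integrableOn_compact (isCompact_uIcc.prod isCompact_uIcc)).mono_set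
      (Set.prod_mono Set.uIoc_subset_uIcc Set.uIoc_subset_uIcc)
  rw [circleAverage_def, circleAverage_def, smul_eq_mul, smul_eq_mul]
  refine mul_le_mul_of_nonneg_left (hle.trans_eq ?_) h2π
  rw [intervalIntegral.integral_const_mul, MeasureTheory.intervalIntegral_intervalIntegral_swap hint,
    ← intervalIntegral.integral_const_mul]
  exact intervalIntegral.integral_congr fun t _ => hin t

/-- Bounded convergence for circle averages. -/
theorem tendsto_circleAverage_of_bounded {ι : Type*} {l : Filter ι} [l.IsCountablyGenerated]
    {F : ι → ℂ → ℝ} {f : ℂ → ℝ} {R : ℝ} (hR : 0 ≤ R) (M : ℝ)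
    (hF : ∀ᶠ n in l, ContinuousOn (F n) (Metric.sphere 0 R))
    (hb : ∀ᶠ n in l, ∀ z ∈ Metric.sphere (0 : ℂ) R, |F n z| ≤ M)
    (hlim : ∀ z ∈ Metric.sphere (0 : ℂ) R, Tendsto (fun n => F n z) l (𝓝 (f z))) :
    Tendsto (fun n => circleAverage (F n) 0 R) l (𝓝 (circleAverage f 0 R)) := by
  simp only [circleAverage_def]
  refine Tendsto.const_smul ?_ _
  refine intervalIntegral.tendsto_integral_filter_of_dominated_convergence (fun _ => M) ?_ ?_
    intervalIntegrable_const ?_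
  · filter_upwards [hF] with n hn
    exact (hn.comp_continuous (continuous_circleMap 0 R)
      (circleMap_mem_sphere 0 hR)).aestronglyMeasurable
  · filter_upwards [hb] with n hn
    exact MeasureTheory.ae_of_all _ fun t _ => hn _ (circleMap_mem_sphere 0 hR t)
  · exact MeasureTheory.ae_of_all _ fun t _ => hlim _ (circleMap_mem_sphere 0 hR t)

/-- On the circle `z φ' / φ` is the rate at which the argument of `φ` turns; it is the Poisson
kernel at `a`. -/
theorem DiscAut.mul_deriv_eq (φ : DiscAut) {z : ℂ} (hz : ‖z‖ = 1) :
    z * ((φ.lam : ℂ) * (1 - (‖(φ.a : ℂ)‖ : ℂ) ^ 2) /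
      (1 - (starRingEnd ℂ) (φ.a : ℂ) * z) ^ 2) = poissonKernel 0 φ.a z * φ.eval z := by
  have hza : z - φ.a ≠ 0 := sub_ne_zero.2 (DiscAut.ne_coe_of_norm_eq_one hz _)
  have hzz : (starRingEnd ℂ) z * z = 1 := by rw [Complex.conj_mul', hz]; simp
  have hd := φ.den_ne_zero hz.le
  have h1 : 1 - (starRingEnd ℂ) (φ.a : ℂ) * z = z * (starRingEnd ℂ) (z - φ.a) := by
    rw [map_sub]
    linear_combination -hzz
  rw [poissonKernel_def, DiscAut.eval, sub_zero, sub_zero, hz]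
  push_cast
  rw [← Complex.conj_mul' (z - φ.a)]
  rw [h1] at hd ⊢
  have h2 := right_ne_zero_of_mul hd
  have h3 := left_ne_zero_of_mul hd
  field_simp

/-- Change of variables on the circle under a disc automorphism. -/
theorem DiscAut.circleAverage_comp (φ : DiscAut) {G : ℂ → ℝ}
    (hG : ContinuousOn G (Metric.sphere 0 1)) :
    circleAverage (fun z => poissonKernel 0 φ.a z * G (φ.eval z)) 0 1 = circleAverage G 0 1 := by
  have ha : (φ.a : ℂ) ∈ Metric.ball (0 : ℂ) 1 := by simpa using φ.a.norm_lt_one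
  set P : ℝ → ℝ := fun t => poissonKernel 0 φ.a (circleMap 0 1 t) with hP
  have hPc : Continuous P := (continuousOn_poissonKernel ha).comp_continuous
    (continuous_circleMap 0 1) (circleMap_mem_sphere 0 zero_le_one)
  -- A continuous argument of `φ (e^{it})`, built by integrating its rate of turning, so that no
  -- branch of the logarithm is needed along the circle.
  set α : ℝ → ℝ := fun t => (φ.eval 1).arg + ∫ s in (0 : ℝ)..t, P s with hα
  have hαd : ∀ t, HasDerivAt α (P t) t := fun t =>
    (intervalIntegral.integral_hasDerivAt_right (hPc.intervalIntegrable _ _)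
      (hPc.stronglyMeasurableAtFilter _ _) hPc.continuousAt).const_add _
  have hnorm : ∀ t, ‖circleMap 0 1 t‖ = 1 := fun t => by simp
  have hE : ∀ t, HasDerivAt (fun t : ℝ => Complex.exp (-(α t * Complex.I)) *
      φ.eval (circleMap 0 1 t)) 0 t := by
    intro t
    have h1 : HasDerivAt (fun t : ℝ => Complex.exp (-(α t * Complex.I)))
        (Complex.exp (-(α t * Complex.I)) * -((P t : ℂ) * Complex.I)) t :=
      (((hαd t).ofReal_comp.mul_const Complex.I).neg).cexp
    have h2 := (φ.hasDerivAt_eval (hnorm t).le).comp t (hasDerivAt_circleMap 0 1 t)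
    refine (h1.mul h2).congr_deriv ?_
    have h3 := φ.mul_deriv_eq (hnorm t)
    simp only [Function.comp_apply]
    linear_combination (Complex.exp (-(α t * Complex.I)) * Complex.I) * h3
  have hconst := is_const_of_deriv_eq_zero (fun t => (hE t).differentiableAt)
    (fun t => (hE t).deriv)
  have hlift : ∀ t, φ.eval (circleMap 0 1 t) = circleMap 0 1 (α t) := by
    intro t
    have h1 := hconst t 0
    have h2 : φ.eval 1 = Complex.exp ((φ.eval 1).arg * Complex.I) := by
      conv_lhs => rw [← Complex.norm_mul_exp_arg_mul_I (φ.eval 1),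
        φ.norm_eval_eq_one (norm_one)]
      simp
    have h3 : circleMap 0 1 0 = 1 := by simp [circleMap]
    have h4 : α 0 = (φ.eval 1).arg := by simp [hα]
    rw [h3, h4, Complex.exp_neg, Complex.exp_neg, ← h2, inv_mul_cancel₀] at h1
    · rw [circleMap_zero (θ := α t), Complex.ofReal_one, one_mul]
      rw [inv_mul_eq_one₀ (Complex.exp_ne_zero _)] at h1
      exact h1.symm
    · intro h
      have := φ.norm_eval_eq_one norm_one
      rw [h] at this
      simp at this
  -- The winding number is one because the Poisson kernel has mean one.
  have h2π : α (2 * π) = α 0 + 2 * π := by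
    have := circleAverage_poissonKernel ha
    rw [circleAverage_def, smul_eq_mul, inv_mul_eq_one₀ (by positivity)] at this
    simp [hα, hP, ← this]
  have hGc : Continuous fun t => G (circleMap 0 1 t) :=
    hG.comp_continuous (continuous_circleMap 0 1) (circleMap_mem_sphere 0 zero_le_one)
  rw [circleAverage_def, circleAverage_def]
  congr 1
  have hsub := intervalIntegral.integral_comp_mul_deriv (a := 0) (b := 2 * π)
    (f := α) (f' := P) (g := fun t => G (circleMap 0 1 t)) (fun t _ => hαd t)
    hPc.continuousOn hGc
  have hper : Function.Periodic (fun t => G (circleMap 0 1 t)) (2 * π) := fun t => by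
    simp only [periodic_circleMap 0 1 t]
  rw [h2π, hper.intervalIntegral_add_eq (α 0) 0, zero_add] at hsub
  rw [← hsub]
  refine intervalIntegral.integral_congr fun t _ => ?_
  simp only [Function.comp_apply, hlift, hP, mul_comm]

/-! ### Elementary properties of Hardy spaces -/

theorem zeroExt_of_lt (f : 𝔻 → ℂ) {z : ℂ} (hz : ‖z‖ < 1) :
    zeroExt f z = f (Complex.UnitDisc.mk z hz) := by
  simp [zeroExt, hz]

@[simp] theorem zeroExt_coe (f : 𝔻 → ℂ) (z : 𝔻) : zeroExt f z = f z := by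
  rw [zeroExt_of_lt f z.norm_lt_one, Complex.UnitDisc.mk_coe]

theorem zeroExt_mul (f g : 𝔻 → ℂ) : zeroExt (f * g) = zeroExt f * zeroExt g := by
  funext z
  simp only [zeroExt, Pi.mul_apply]
  split_ifs <;> simp

theorem zeroExt_eqOn {f : 𝔻 → ℂ} {F : ℂ → ℂ} (h : ∀ z : 𝔻, f z = F z) :
    Set.EqOn (zeroExt f) F (Metric.ball 0 1) := fun z hz => by
  rw [zeroExt_of_lt f (by simpa using hz), h]
  rfl

theorem isAnalytic_of_eq {f : 𝔻 → ℂ} {F : ℂ → ℂ} (hF : DifferentiableOn ℂ F (Metric.ball 0 1))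
    (h : ∀ z : 𝔻, f z = F z) : IsAnalytic f :=
  hF.congr (zeroExt_eqOn h)

theorem IsAnalytic.mul {f g : 𝔻 → ℂ} (hf : IsAnalytic f) (hg : IsAnalytic g) :
    IsAnalytic (f * g) := by
  rw [IsAnalytic, zeroExt_mul]
  exact DifferentiableOn.mul hf hg

theorem sphere_subset_ball {r : ℝ} (hr : r ∈ Set.Ioo (0 : ℝ) 1) :
    Metric.sphere (0 : ℂ) r ⊆ Metric.ball 0 1 := fun z hz => by
  simp only [mem_sphere_iff_norm, sub_zero] at hz
  simpa [hz] using hr.2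

variable {p : ℝ}

theorem hpMean_eq_of_eqOn {f : 𝔻 → ℂ} {F : ℂ → ℝ} {r : ℝ} (hr : r ∈ Set.Ioo (0 : ℝ) 1)
    (h : ∀ z : 𝔻, ‖f z‖ ^ p = F z) : hpMean p f r = circleAverage F 0 r := by
  refine circleAverage_congr_sphere fun z hz => ?_
  rw [abs_of_pos hr.1] at hz
  have hz1 : ‖z‖ < 1 := by simpa using sphere_subset_ball hr hz
  simp only [zeroExt_of_lt f hz1, h]
  rfl

theorem hpMean_congr {f g : 𝔻 → ℂ} {r : ℝ} (hr : r ∈ Set.Ioo (0 : ℝ) 1)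
    (h : ∀ z, ‖f z‖ = ‖g z‖) : hpMean p f r = hpMean p g r :=
  hpMean_eq_of_eqOn hr fun z => by rw [h, zeroExt_coe]

theorem hpMean_le_of_norm_le (hp : 1 ≤ p) {f g : 𝔻 → ℂ} (hf : IsAnalytic f) (hg : IsAnalytic g) {r : ℝ}
    (hr : r ∈ Set.Ioo (0 : ℝ) 1) (h : ∀ z, ‖f z‖ ≤ ‖g z‖) : hpMean p f r ≤ hpMean p g r := by
  refine circleAverage_mono (circleIntegrable_of_isAnalytic hp hf hr)
    (circleIntegrable_of_isAnalytic hp hg hr) fun z hz => ?_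
  rw [abs_of_pos hr.1] at hz
  have hz1 : ‖z‖ < 1 := by simpa using sphere_subset_ball hr hz
  rw [zeroExt_of_lt f hz1, zeroExt_of_lt g hz1]
  exact Real.rpow_le_rpow (norm_nonneg _) (h _) (by linarith)

theorem hpMean_mono (hp : 1 ≤ p) {f : 𝔻 → ℂ} (hf : IsAnalytic f) {r s : ℝ} (hr : 0 < r) (hrs : r < s)
    (hs : s < 1) : hpMean p f r ≤ hpMean p f s := by
  refine circleAverage_rpow_norm_mono hp hr hrs (DifferentiableOn.diffContOnCl ?_)
  refine hf.mono ?_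
  rw [closure_ball _ (hr.trans hrs).ne']
  exact Metric.closedBall_subset_ball hs

/-- The `p`-th power of the Hardy space norm. -/
noncomputable def hpSup (p : ℝ) (f : 𝔻 → ℂ) : ℝ := ⨆ r : Set.Ioo (0 : ℝ) 1, hpMean p f r

theorem hpNorm_eq (p : ℝ) (f : 𝔻 → ℂ) : hpNorm p f = hpSup p f ^ (1 / p) := rfl

instance : Nonempty (Set.Ioo (0 : ℝ) 1) := ⟨⟨1 / 2, by norm_num⟩⟩

variable {hp : 1 ≤ p}

theorem hpMean_le_hpSup {f : 𝔻 → ℂ} (hf : f ∈ Hp p hp) {r : ℝ} (hr : r ∈ Set.Ioo (0 : ℝ) 1) :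
    hpMean p f r ≤ hpSup p f := by
  obtain ⟨-, C, hC⟩ := hf
  exact le_ciSup (f := fun r : Set.Ioo (0 : ℝ) 1 => hpMean p f r)
    ⟨C, by rintro _ ⟨r, rfl⟩; exact hC r r.2⟩ ⟨r, hr⟩

theorem hpSup_le {f : 𝔻 → ℂ} {C : ℝ} (h : ∀ r ∈ Set.Ioo (0 : ℝ) 1, hpMean p f r ≤ C) :
    hpSup p f ≤ C := ciSup_le fun r => h r r.2

theorem hpSup_congr {f g : 𝔻 → ℂ} (h : ∀ z, ‖f z‖ = ‖g z‖) : hpSup p f = hpSup p g :=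
  iSup_congr fun r => hpMean_congr r.2 h

theorem mem_Hp_of_norm_le {f g : 𝔻 → ℂ} (hf : IsAnalytic f) (hg : g ∈ Hp p hp)
    (h : ∀ z, ‖f z‖ ≤ ‖g z‖) : f ∈ Hp p hp ∧ hpSup p f ≤ hpSup p g := by
  have key : ∀ r ∈ Set.Ioo (0 : ℝ) 1, hpMean p f r ≤ hpSup p g := fun r hr =>
    (hpMean_le_of_norm_le hp hf hg.1 hr h).trans (hpMean_le_hpSup hg hr)
  exact ⟨⟨hf, _, key⟩, hpSup_le key⟩

theorem mul_mem_Hp {b f : 𝔻 → ℂ} (hb : IsAnalytic b) (hb1 : ∀ z, ‖b z‖ ≤ 1)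
    (hf : f ∈ Hp p hp) : b * f ∈ Hp p hp ∧ hpSup p (b * f) ≤ hpSup p f :=
  mem_Hp_of_norm_le (hb.mul hf.1) hf fun z => by
    rw [Pi.mul_apply, norm_mul]
    exact mul_le_of_le_one_left (norm_nonneg _) (hb1 z)

theorem const_mem_Hp (c : ℂ) : (fun _ => c) ∈ Hp p hp := by
  refine ⟨isAnalytic_of_eq (F := fun _ => c) (differentiableOn_const _) fun _ => rfl,
    ‖c‖ ^ p, fun r hr => ?_⟩
  rw [hpMean_eq_of_eqOn (F := fun _ => ‖c‖ ^ p) hr fun _ => rfl, circleAverage_const]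

theorem mem_Hp_of_bounded {f : 𝔻 → ℂ} (hf : IsAnalytic f) {C : ℝ} (h : ∀ z, ‖f z‖ ≤ C) :
    f ∈ Hp p hp :=
  (mem_Hp_of_norm_le hf (const_mem_Hp (C : ℂ)) fun z => by
    rw [Complex.norm_real]
    exact (h z).trans (le_abs_self C)).1

/-! ### The weighted composition operators -/

namespace DiscAut

variable (φ : DiscAut)

theorem conj_lam_mul_deriv {z : ℂ} (hz : ‖z‖ ≤ 1) :
    (starRingEnd ℂ) (φ.lam : ℂ) * deriv φ.eval z =
      ((1 - ‖(φ.a : ℂ)‖ ^ 2 : ℝ) : ℂ) * ((1 - (starRingEnd ℂ) (φ.a : ℂ) * z)⁻¹) ^ 2 := by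
  rw [(φ.hasDerivAt_eval hz).deriv]
  push_cast
  rw [inv_pow, ← div_eq_mul_inv, mul_div_assoc', ← mul_assoc, φ.conj_lam_mul_lam, one_mul]

/-- A positive multiple of the square of a number with positive real part avoids the negative axis,
so the principal power is analytic here. -/
theorem conj_lam_mul_deriv_mem_slitPlane {z : ℂ} (hz : ‖z‖ ≤ 1) :
    (starRingEnd ℂ) (φ.lam : ℂ) * deriv φ.eval z ∈ Complex.slitPlane := by
  rw [φ.conj_lam_mul_deriv hz]
  have hN : 0 < 1 - ‖(φ.a : ℂ)‖ ^ 2 := by linarith [φ.sq_norm_a_lt]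
  have hre : 0 < ((1 - (starRingEnd ℂ) (φ.a : ℂ) * z)⁻¹).re := by
    rw [Complex.inv_re]
    refine div_pos ?_ (Complex.normSq_pos.2 (φ.den_ne_zero hz))
    have h1 := norm_conj_mul_lt φ.a.norm_lt_one hz
    have h2 := Complex.re_le_norm ((starRingEnd ℂ) (φ.a : ℂ) * z)
    rw [Complex.sub_re, Complex.one_re]
    linarith
  generalize (1 - (starRingEnd ℂ) (φ.a : ℂ) * z)⁻¹ = u at hre
  rw [Complex.mem_slitPlane_iff, Complex.re_ofReal_mul, Complex.im_ofReal_mul]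
  by_cases hu : u.im = 0
  · left
    rw [pow_two u, Complex.mul_re, hu, mul_zero, sub_zero]
    exact mul_pos hN (by positivity)
  · right
    refine mul_ne_zero hN.ne' ?_
    rw [pow_two, Complex.mul_im]
    have := mul_ne_zero hre.ne' hu
    intro h
    apply this
    linarith [mul_comm u.re u.im]

/-- The weight as a function on the plane. -/
noncomputable def weightExt (p : ℝ) (z : ℂ) : ℂ :=
  ((starRingEnd ℂ) (φ.lam : ℂ) * deriv φ.eval z) ^ ((1 / p : ℝ) : ℂ)

theorem differentiableOn_weightExt (p : ℝ) :
    DifferentiableOn ℂ (φ.weightExt p) (Metric.closedBall 0 1) := by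
  have h : DifferentiableOn ℂ (fun z => (starRingEnd ℂ) (φ.lam : ℂ) * deriv φ.eval z)
      (Metric.closedBall 0 1) := by
    refine DifferentiableOn.congr (f := fun z => ((1 - ‖(φ.a : ℂ)‖ ^ 2 : ℝ) : ℂ) *
      ((1 - (starRingEnd ℂ) (φ.a : ℂ) * z)⁻¹) ^ 2) ?_
      fun z hz => φ.conj_lam_mul_deriv (by simpa using hz)
    refine (DifferentiableOn.pow (DifferentiableOn.inv (by fun_prop) fun z hz => ?_) 2).const_mul _
    exact φ.den_ne_zero (by simpa using hz)
  exact h.cpow (differentiableOn_const _) fun z hz =>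
    φ.conj_lam_mul_deriv_mem_slitPlane (by simpa using hz)

theorem norm_weightExt_rpow {p : ℝ} (hp : 1 ≤ p) {z : ℂ} (hz : ‖z‖ = 1) :
    ‖φ.weightExt p z‖ ^ p = poissonKernel 0 φ.a z := by
  have hN : 0 < 1 - ‖(φ.a : ℂ)‖ ^ 2 := by linarith [φ.sq_norm_a_lt]
  rw [weightExt, Complex.norm_cpow_real, ← Real.rpow_mul (norm_nonneg _),
    one_div_mul_cancel (by linarith), Real.rpow_one, φ.conj_lam_mul_deriv hz.le, norm_mul,
    Complex.norm_real, Real.norm_of_nonneg hN.le, norm_pow, norm_inv, poissonKernel_def, sub_zero,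
    sub_zero, hz, inv_pow, ← div_eq_mul_inv, one_pow]
  congr 1
  have := sq_norm_one_sub_conj_mul_sub (φ.a : ℂ) z
  rw [hz] at this
  linarith

theorem U_apply (p : ℝ) (f : 𝔻 → ℂ) (z : 𝔻) :
    U p φ f z = φ.weightExt p z * f (φ.map z) := rfl

/-- By the chain rule the two weights have reciprocal bases; off the negative axis the principal
power respects inversion. -/
theorem U_inv_U (p : ℝ) (f : 𝔻 → ℂ) : U p φ.inv (U p φ f) = f := by
  funext z
  obtain ⟨w, rfl⟩ : ∃ w, φ.map w = z := ⟨_, φ.map_inv_map z⟩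
  rw [U_apply, U_apply, inv_map_map]
  have hw := w.norm_lt_one
  have h1 : deriv φ.inv.eval (φ.map w) * deriv φ.eval w = 1 := by
    have hd := ((φ.inv.hasDerivAt_eval (φ.map w).norm_lt_one.le).comp (w : ℂ)
      (φ.hasDerivAt_eval hw.le))
    have hid : HasDerivAt (φ.inv.eval ∘ φ.eval) 1 (w : ℂ) := by
      refine (hasDerivAt_id (w : ℂ)).congr_of_eventuallyEq ?_
      filter_upwards [Metric.isOpen_ball.mem_nhds (show (w : ℂ) ∈ Metric.ball 0 1 by simpa using hw)]
        with v hv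
      exact φ.inv_eval_eval (by simpa using (Metric.mem_ball.1 hv).le)
    rw [(φ.inv.hasDerivAt_eval (φ.map w).norm_lt_one.le).deriv, (φ.hasDerivAt_eval hw.le).deriv]
    exact hd.unique hid
  have h2 : (starRingEnd ℂ) (φ.inv.lam : ℂ) * deriv φ.inv.eval (φ.map w) =
      ((starRingEnd ℂ) (φ.lam : ℂ) * deriv φ.eval w)⁻¹ := by
    rw [inv_lam, Complex.conj_conj]
    refine eq_inv_of_mul_eq_one_left ?_
    linear_combination ((starRingEnd ℂ) (φ.lam : ℂ) * φ.lam) * h1 + φ.conj_lam_mul_lam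
  have h3 := φ.conj_lam_mul_deriv_mem_slitPlane hw.le
  rw [weightExt, weightExt, h2, Complex.inv_cpow _ _ (Complex.mem_slitPlane_iff_arg.1 h3).1,
    ← mul_assoc, inv_mul_cancel₀, one_mul]
  rw [Complex.cpow_ne_zero_iff]
  exact Or.inl (Complex.slitPlane_ne_zero h3)

theorem U_U_inv (p : ℝ) (f : 𝔻 → ℂ) : U p φ (U p φ.inv f) = f := by
  simpa [inv_inv] using φ.inv.U_inv_U p f

theorem isAnalytic_U (p : ℝ) {f : 𝔻 → ℂ} (hf : IsAnalytic f) : IsAnalytic (U p φ f) := by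
  refine isAnalytic_of_eq (F := fun z => φ.weightExt p z * zeroExt f (φ.eval z)) ?_ fun z => ?_
  · refine ((φ.differentiableOn_weightExt p).mono Metric.ball_subset_closedBall).mul
      (DifferentiableOn.comp hf (φ.differentiableOn_eval.mono Metric.ball_subset_closedBall) ?_)
    intro z hz
    simpa using φ.norm_eval_lt_one z (by simpa using hz)
  · rw [U_apply, ← coe_map, zeroExt_coe]

/-- For `s < 1` the dilate `F (s ·)` extends past the circle. Monotonicity of means moves the
estimate from radius `r` to radius `1`, where the change of variables yields the mean of `f` at
radius `s`; then `s → 1`. -/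
theorem hpMean_U_le {f : 𝔻 → ℂ} (hf : f ∈ Hp p hp) {r : ℝ} (hr : r ∈ Set.Ioo (0 : ℝ) 1) :
    hpMean p (U p φ f) r ≤ hpSup p f := by
  have hp0 : 0 ≤ p := by linarith
  have hW := φ.differentiableOn_weightExt p
  set F := zeroExt f with hF
  have hFd : DifferentiableOn ℂ F (Metric.ball 0 1) := hf.1
  have hmaps : ∀ s ∈ Set.Ioo (0 : ℝ) 1, Set.MapsTo (fun z : ℂ => (s : ℂ) * z)
      (Metric.closedBall 0 1) (Metric.ball 0 1) := by
    intro s hs z hz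
    simp only [mem_closedBall_zero_iff, mem_ball_zero_iff, norm_mul, Complex.norm_real,
      Real.norm_of_nonneg hs.1.le] at hz ⊢
    nlinarith [hs.1, hs.2]
  have hφ : Set.MapsTo φ.eval (Metric.closedBall 0 1) (Metric.closedBall 0 1) := fun z hz => by
    simpa using φ.norm_eval_le_one (by simpa using hz)
  have hdil : ∀ s ∈ Set.Ioo (0 : ℝ) 1,
      circleAverage (fun z => ‖φ.weightExt p z * F (s * φ.eval z)‖ ^ p) 0 r ≤ hpSup p f := by
    intro s hs
    have hFs : DifferentiableOn ℂ (fun z => F (s * z)) (Metric.closedBall 0 1) :=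
      hFd.comp (by fun_prop) (hmaps s hs)
    have hH : DiffContOnCl ℂ (fun z => φ.weightExt p z * F (s * φ.eval z)) (Metric.ball 0 1) := by
      refine DifferentiableOn.diffContOnCl ?_
      rw [closure_ball _ one_ne_zero]
      exact hW.mul (hFs.comp φ.differentiableOn_eval hφ)
    refine (circleAverage_rpow_norm_mono hp hr.1 hr.2 hH).trans ?_
    have h1 : circleAverage (fun z => ‖φ.weightExt p z * F (s * φ.eval z)‖ ^ p) 0 1 =
        circleAverage (fun z => poissonKernel 0 φ.a z * ‖F (s * φ.eval z)‖ ^ p) 0 1 := by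
      refine circleAverage_congr_sphere fun z hz => ?_
      have hz1 : ‖z‖ = 1 := by simpa using hz
      simp only [norm_mul]
      rw [Real.mul_rpow (norm_nonneg _) (norm_nonneg _), φ.norm_weightExt_rpow hp hz1]
    rw [h1, φ.circleAverage_comp (G := fun z => ‖F (s * z)‖ ^ p)]
    · have h2 : circleAverage (fun z => ‖F (s * z)‖ ^ p) 0 1 = hpMean p f s := by
        rw [hpMean, circleAverage_def, circleAverage_def]
        simp [circleMap, hF]
      rw [h2]
      exact hpMean_le_hpSup hf hs
    · exact (hFs.continuousOn.mono Metric.sphere_subset_closedBall).norm.rpow_const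
        fun _ _ => Or.inr hp0
  have hrs : Metric.sphere (0 : ℂ) r ⊆ Metric.ball 0 1 := sphere_subset_ball hr
  have hjoint : ContinuousOn
      (fun q : ℝ × ℂ => ‖φ.weightExt p q.2 * F (q.1 * φ.eval q.2)‖ ^ p)
      (Set.Icc 0 1 ×ˢ Metric.sphere 0 r) := by
    refine (ContinuousOn.norm (ContinuousOn.mul ?_ ?_)).rpow_const fun _ _ => Or.inr hp0
    · exact hW.continuousOn.comp continuousOn_snd fun q hq =>
        Metric.ball_subset_closedBall (hrs hq.2)
    · refine hFd.continuousOn.comp (ContinuousOn.mul (by fun_prop)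
        (φ.differentiableOn_eval.continuousOn.comp continuousOn_snd fun q hq =>
          Metric.ball_subset_closedBall (hrs hq.2))) fun q hq => ?_
      have h1 := φ.norm_eval_lt_one q.2 (by simpa using hrs hq.2)
      simp only [mem_ball_zero_iff, norm_mul, Complex.norm_real, Real.norm_of_nonneg hq.1.1]
      nlinarith [hq.1.1, hq.1.2, norm_nonneg (φ.eval q.2)]
  obtain ⟨M, hM⟩ := (isCompact_Icc.prod (isCompact_sphere (0 : ℂ) r)).exists_bound_of_continuousOn
    hjoint
  have hev : ∀ᶠ s : ℝ in 𝓝[<] 1, s ∈ Set.Ioo (0 : ℝ) 1 := Ioo_mem_nhdsLT one_pos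
  have hlim := tendsto_circleAverage_of_bounded (l := 𝓝[<] (1 : ℝ))
    (F := fun s z => ‖φ.weightExt p z * F (s * φ.eval z)‖ ^ p)
    (f := fun z => ‖φ.weightExt p z * F ((1 : ℝ) * φ.eval z)‖ ^ p) hr.1.le M ?_ ?_ ?_
  · have h3 : hpMean p (U p φ f) r =
        circleAverage (fun z => ‖φ.weightExt p z * F ((1 : ℝ) * φ.eval z)‖ ^ p) 0 r := by
      refine hpMean_eq_of_eqOn hr fun z => ?_
      rw [U_apply, Complex.ofReal_one, one_mul, ← coe_map, hF, zeroExt_coe]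
    rw [h3]
    exact le_of_tendsto hlim (hev.mono hdil)
  · filter_upwards [hev] with s hs
    exact hjoint.comp (f := fun z : ℂ => (s, z)) (by fun_prop)
      fun z hz => ⟨⟨hs.1.le, hs.2.le⟩, hz⟩
  · filter_upwards [hev] with s hs z hz
    exact hM (s, z) ⟨⟨hs.1.le, hs.2.le⟩, hz⟩
  · intro z hz
    have h4 : ContinuousWithinAt (fun s : ℝ => ‖φ.weightExt p z * F (s * φ.eval z)‖ ^ p)
        (Set.Icc 0 1) 1 :=
      (hjoint.comp (f := fun s : ℝ => (s, z)) (by fun_prop) fun s hs => ⟨hs, hz⟩) 1 (by simp)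
    exact h4.tendsto.mono_left (nhdsWithin_le_of_mem
      (mem_of_superset (Ioo_mem_nhdsLT one_pos) Set.Ioo_subset_Icc_self))

theorem U_mem_Hp {f : 𝔻 → ℂ} (hf : f ∈ Hp p hp) : U p φ f ∈ Hp p hp :=
  ⟨φ.isAnalytic_U p hf.1, _, fun _ hr => φ.hpMean_U_le hf hr⟩

theorem hpSup_U {f : 𝔻 → ℂ} (hf : f ∈ Hp p hp) : hpSup p (U p φ f) = hpSup p f := by
  refine le_antisymm (hpSup_le fun r hr => φ.hpMean_U_le hf hr) ?_
  conv_lhs => rw [← φ.U_inv_U p f]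
  exact hpSup_le fun r hr => φ.inv.hpMean_U_le (φ.U_mem_Hp hf) hr

theorem exists_U_pow_eq {f : 𝔻 → ℂ} (hf : f ∈ Hp p hp) (n : ℕ) :
    ∃ g ∈ Hp p hp, (U p φ ^ n) g = f := by
  induction n generalizing f with
  | zero => exact ⟨f, hf, rfl⟩
  | succ n ih =>
    obtain ⟨g, hg, rfl⟩ := ih hf
    exact ⟨U p φ.inv g, φ.inv.U_mem_Hp hg, by rw [pow_succ, Module.End.mul_apply, U_U_inv]⟩

end DiscAut

/-! ### Blaschke products -/

theorem isOpenEmbedding_coe_unitDisc : IsOpenEmbedding ((↑) : 𝔻 → ℂ) := by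
  refine ⟨Complex.UnitDisc.isEmbedding_coe, ?_⟩
  have : Set.range ((↑) : 𝔻 → ℂ) = Metric.ball 0 1 := by
    ext z
    simp only [Set.mem_range, mem_ball_zero_iff]
    exact ⟨fun ⟨w, hw⟩ => hw ▸ w.norm_lt_one, fun hz => ⟨Complex.UnitDisc.mk z hz, rfl⟩⟩
  rw [this]
  exact Metric.isOpen_ball

theorem tendsto_of_tendstoLocallyUniformly {G : ℕ → 𝔻 → ℂ} {Ψ : 𝔻 → ℂ}
    (h : TendstoLocallyUniformly G Ψ atTop) (z : 𝔻) :
    Tendsto (fun n => G n z) atTop (𝓝 (Ψ z)) :=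
  (tendstoLocallyUniformlyOn_univ.2 h).tendsto_at (Set.mem_univ z)

theorem isAnalytic_of_tendstoLocallyUniformly {G : ℕ → ℂ → ℂ} {Ψ : 𝔻 → ℂ}
    (hG : ∀ n, DifferentiableOn ℂ (G n) (Metric.ball 0 1))
    (h : TendstoLocallyUniformly (fun n (z : 𝔻) => G n z) Ψ atTop) : IsAnalytic Ψ := by
  refine TendstoLocallyUniformlyOn.differentiableOn (F := G) (φ := atTop) ?_
    (Eventually.of_forall hG) Metric.isOpen_ball
  intro u hu x hx
  have hx1 : ‖x‖ < 1 := by simpa using hx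
  obtain ⟨t, ht, ht'⟩ := h u hu (Complex.UnitDisc.mk x hx1)
  have ht2 : ((↑) : 𝔻 → ℂ) '' t ∈ 𝓝 x :=
    isOpenEmbedding_coe_unitDisc.image_mem_nhds (x := Complex.UnitDisc.mk x hx1) |>.2 ht
  refine ⟨_, mem_nhdsWithin_of_mem_nhds ht2, ht'.mono ?_⟩
  rintro n hn _ ⟨z, hz, rfl⟩
  rw [zeroExt_coe]
  exact hn z hz

theorem tendstoLocallyUniformly_of_on {G : ℕ → ℂ → ℂ} {Ψ : ℂ → ℂ}
    (h : TendstoLocallyUniformlyOn G Ψ atTop (Metric.ball 0 1)) :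
    TendstoLocallyUniformly (fun n (z : 𝔻) => G n z) (fun z : 𝔻 => Ψ z) atTop := by
  rw [← tendstoLocallyUniformlyOn_univ]
  exact h.comp (fun z : 𝔻 => (z : ℂ)) (fun z _ => by simpa using z.norm_lt_one)
    Complex.UnitDisc.continuous_coe.continuousOn

theorem DiscAut.differentiableOn_eval_ball (φ : DiscAut) :
    DifferentiableOn ℂ φ.eval (Metric.ball 0 1) :=
  φ.differentiableOn_eval.mono Metric.ball_subset_closedBall

theorem DiscAut.norm_eval_zero (φ : DiscAut) : ‖φ.eval 0‖ = ‖(φ.a : ℂ)‖ := by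
  simp [norm_eval]

theorem eq_prod_mul_tail {u : ℕ → Circle} {h R : ℕ → ℂ → ℂ}
    (hR : ∀ n, ∀ z ∈ Metric.ball (0 : ℂ) 1, R n z = u n * h n z * R (n + 1) z) (n : ℕ) {z : ℂ}
    (hz : z ∈ Metric.ball (0 : ℂ) 1) :
    R 0 z = (∏ k ∈ Finset.range n, (u k : ℂ)) * (∏ k ∈ Finset.range n, h k z) * R n z := by
  induction n with
  | zero => simp
  | succ n ih =>
    rw [ih, hR n z hz, Finset.prod_range_succ, Finset.prod_range_succ]
    ring

section Blaschke

variable {b : ℕ → DiscAut} {Ψ : 𝔻 → ℂ}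

theorem isAnalytic_blaschke (hΨ : TendstoLocallyUniformly
    (fun (n : ℕ) (z : 𝔻) => ∏ k ∈ Finset.range n, (b k).eval z) Ψ atTop) : IsAnalytic Ψ :=
  isAnalytic_of_tendstoLocallyUniformly
    (fun _ => DifferentiableOn.fun_finsetProd fun k _ => (b k).differentiableOn_eval_ball) hΨ

theorem norm_blaschke_le_one (hΨ : TendstoLocallyUniformly
    (fun (n : ℕ) (z : 𝔻) => ∏ k ∈ Finset.range n, (b k).eval z) Ψ atTop) (z : 𝔻) :
    ‖Ψ z‖ ≤ 1 := by
  refine le_of_tendsto (tendsto_of_tendstoLocallyUniformly hΨ z).norm (Eventually.of_forall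
    fun n => ?_)
  rw [norm_prod]
  exact Finset.prod_le_one (fun _ _ => norm_nonneg _)
    fun k _ => (b k).norm_eval_le_one z.norm_lt_one.le

theorem blaschke_apply_zero (hΨ : TendstoLocallyUniformly
    (fun (n : ℕ) (z : 𝔻) => ∏ k ∈ Finset.range n, (b k).eval z) Ψ atTop) (k : ℕ) :
    Ψ (b k).a = 0 := by
  refine tendsto_nhds_unique (tendsto_of_tendstoLocallyUniformly hΨ (b k).a)
    (tendsto_const_nhds.congr' ?_)
  filter_upwards [eventually_gt_atTop k] with n hn
  refine (Finset.prod_eq_zero (Finset.mem_range.2 hn) ?_).symm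
  simp [DiscAut.eval]

/-- Up to unimodular constants a Blaschke product is the product of a finite partial product and
an analytic tail, and the tails converge to one. -/
theorem exists_blaschke_tail (hs : Summable fun k => 1 - ‖((b k).a : ℂ)‖)
    (hΨ : TendstoLocallyUniformly
      (fun (n : ℕ) (z : 𝔻) => ∏ k ∈ Finset.range n, (b k).eval z) Ψ atTop) :
    ∃ T : ℕ → 𝔻 → ℂ, (∀ n, IsAnalytic (T n)) ∧ (∀ n z, ‖T n z‖ ≤ 1) ∧
      (∀ n z, ‖Ψ z‖ = ‖∏ k ∈ Finset.range n, (b k).eval z‖ * ‖T n z‖) ∧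
      ∀ z, Tendsto (fun n => T n z) atTop (𝓝 1) := by
  obtain ⟨u, R, hRd, hRb, hR, hR1, hRlim⟩ := exists_product (h := fun k => (b k).eval)
    (fun k => (b k).differentiableOn_eval_ball)
    (fun k z hz => (b k).norm_eval_le_one (by simpa using (Metric.mem_ball.1 hz).le))
    (by simpa only [DiscAut.norm_eval_zero] using hs)
  have hmem : ∀ z : 𝔻, (z : ℂ) ∈ Metric.ball (0 : ℂ) 1 := fun z => by simpa using z.norm_lt_one
  refine ⟨fun n z => R n z, fun n => isAnalytic_of_eq (hRd n) fun _ => rfl,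
    fun n z => hRb n z (hmem z), fun n z => ?_, fun z => hR1 z (hmem z)⟩
  -- The corrected and original partial products differ only by unimodular constants.
  have h1 : ‖Ψ z‖ = ‖R 0 z‖ := by
    refine tendsto_nhds_unique (tendsto_of_tendstoLocallyUniformly hΨ z).norm
      ((hRlim.tendsto_at (hmem z)).norm.congr fun n => ?_)
    simp only [norm_prod, norm_mul, Circle.norm_coe, one_mul]
  rw [h1, eq_prod_mul_tail hR n (hmem z), norm_mul, norm_mul, norm_prod]
  simp only [Circle.norm_coe, Finset.prod_const_one, one_mul]

theorem exists_blaschke (a : ℕ → 𝔻) (hs : Summable fun k => 1 - ‖(a k : ℂ)‖) :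
    ∃ (b : ℕ → DiscAut) (Ψ : 𝔻 → ℂ), (∀ k, (b k).a = a k) ∧
      TendstoLocallyUniformly
        (fun (n : ℕ) (z : 𝔻) => ∏ k ∈ Finset.range n, (b k).eval z) Ψ atTop := by
  obtain ⟨u, R, -, -, -, -, hRlim⟩ := exists_product (h := fun k => (DiscAut.ofZero (a k)).eval)
    (fun k => (DiscAut.ofZero (a k)).differentiableOn_eval_ball)
    (fun k z hz => DiscAut.norm_eval_le_one _ (by simpa using (Metric.mem_ball.1 hz).le))
    (by simp only [DiscAut.norm_eval_zero]; exact hs)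
  refine ⟨fun k => ⟨a k, u k⟩, fun z => R 0 z, fun _ => rfl, ?_⟩
  have h : ∀ k z, (DiscAut.mk (a k) (u k)).eval z = u k * (DiscAut.ofZero (a k)).eval z := by
    intro k z
    simp [DiscAut.eval, DiscAut.ofZero, mul_div_assoc]
  simp only [h]
  exact tendstoLocallyUniformly_of_on hRlim

/-! ### Multiplication by Blaschke products is isometric -/

variable {p : ℝ} {hp : 1 ≤ p}

theorem isAnalytic_eval (φ : DiscAut) : IsAnalytic fun z : 𝔻 => φ.eval z :=
  isAnalytic_of_eq φ.differentiableOn_eval_ball fun _ => rfl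

/-- Multiplication by a disc automorphism does not decrease the Hardy norm. -/
theorem hpSup_le_eval_mul (φ : DiscAut) {f : 𝔻 → ℂ} (hf : f ∈ Hp p hp) :
    hpSup p f ≤ hpSup p ((fun z : 𝔻 => φ.eval z) * f) := by
  have hp0 : 0 ≤ p := by linarith
  have hmem := (mul_mem_Hp (isAnalytic_eval φ)
    (fun z => φ.norm_eval_le_one z.norm_lt_one.le) hf).1
  -- From `1 - |a| ≤ |1 - conj a * z|` in the formula for `1 - |φ|²`; it makes `|φ|` tend to one
  -- uniformly at the circle.
  set C : ℝ := (1 - ‖(φ.a : ℂ)‖ ^ 2) / (1 - ‖(φ.a : ℂ)‖) ^ 2 with hC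
  have hN : 0 < 1 - ‖(φ.a : ℂ)‖ ^ 2 := by linarith [φ.sq_norm_a_lt]
  have ha : 0 < 1 - ‖(φ.a : ℂ)‖ := by linarith [φ.a.norm_lt_one]
  have hlow : ∀ z : ℂ, ‖z‖ < 1 → 1 - C * (1 - ‖z‖ ^ 2) ≤ ‖φ.eval z‖ := by
    intro z hz
    have h1 := φ.one_sub_sq_norm_eval hz.le
    have h2 : 1 - ‖(φ.a : ℂ)‖ ≤ ‖1 - (starRingEnd ℂ) (φ.a : ℂ) * z‖ := by
      have h3 := norm_sub_norm_le (1 : ℂ) ((starRingEnd ℂ) (φ.a : ℂ) * z)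
      rw [norm_one, norm_mul, RCLike.norm_conj] at h3
      nlinarith [norm_nonneg (φ.a : ℂ)]
    have hz2 : 0 ≤ 1 - ‖z‖ ^ 2 := by nlinarith [norm_nonneg z]
    have h4 : 1 - ‖φ.eval z‖ ^ 2 ≤ C * (1 - ‖z‖ ^ 2) := by
      rw [h1, hC, div_mul_eq_mul_div]
      gcongr
    nlinarith [norm_nonneg (φ.eval z), φ.norm_eval_le_one hz.le]
  refine hpSup_le fun r hr => ?_
  have hlim : Tendsto (fun s : ℝ => (1 - C * (1 - s ^ 2)) ^ p * hpMean p f r) (𝓝[<] 1)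
      (𝓝 (hpMean p f r)) := by
    have hc : Continuous fun s : ℝ => (1 - C * (1 - s ^ 2)) ^ p * hpMean p f r :=
      (Continuous.rpow_const (by fun_prop) fun _ => Or.inr hp0).mul continuous_const
    have := hc.tendsto 1
    simp only [one_pow, sub_self, mul_zero, sub_zero, Real.one_rpow, one_mul] at this
    exact this.mono_left nhdsWithin_le_nhds
  have hpos : ∀ᶠ s : ℝ in 𝓝[<] 1, 0 < 1 - C * (1 - s ^ 2) := by
    have hc : Continuous fun s : ℝ => 1 - C * (1 - s ^ 2) := by fun_prop
    exact nhdsWithin_le_nhds ((hc.tendsto 1).eventually_const_lt (by norm_num))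
  refine le_of_tendsto hlim ?_
  filter_upwards [hpos, Ioo_mem_nhdsLT hr.2] with s hs hs'
  have hsI : s ∈ Set.Ioo (0 : ℝ) 1 := ⟨hr.1.trans hs'.1, hs'.2⟩
  refine le_trans ?_ (hpMean_le_hpSup hmem hsI)
  refine (mul_le_mul_of_nonneg_left (hpMean_mono hp hf.1 hr.1 hs'.1 hs'.2)
    (by positivity)).trans ?_
  rw [hpMean, hpMean, ← smul_eq_mul, ← circleAverage_smul]
  refine circleAverage_mono ((circleIntegrable_of_isAnalytic hp hf.1 hsI).const_smul)
    (circleIntegrable_of_isAnalytic hp hmem.1 hsI) fun z hz => ?_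
  rw [abs_of_pos hsI.1] at hz
  have hzs : ‖z‖ = s := by simpa using hz
  have hz1 : ‖z‖ < 1 := by rw [hzs]; exact hsI.2
  simp only [zeroExt_of_lt _ hz1, Pi.smul_apply, Pi.mul_apply, norm_mul, smul_eq_mul]
  rw [Real.mul_rpow (norm_nonneg _) (norm_nonneg _)]
  refine mul_le_mul_of_nonneg_right (Real.rpow_le_rpow hs.le ?_ hp0) (by positivity)
  have := hlow z hz1
  rwa [hzs] at this

theorem hpSup_le_prod_eval_mul (b : ℕ → DiscAut) (n : ℕ) {f : 𝔻 → ℂ} (hf : f ∈ Hp p hp) :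
    hpSup p f ≤ hpSup p (fun z => (∏ k ∈ Finset.range n, (b k).eval z) * f z) := by
  induction n generalizing f with
  | zero => simp
  | succ n ih =>
    have hmem := (mul_mem_Hp (isAnalytic_eval (b n))
      (fun z => (b n).norm_eval_le_one z.norm_lt_one.le) hf).1
    refine (hpSup_le_eval_mul (b n) hf).trans ((ih hmem).trans_eq ?_)
    simp only [Finset.prod_range_succ, Pi.mul_apply, mul_assoc]

/-- Multiplication by a Blaschke product preserves the Hardy norm. -/
theorem hpSup_blaschke_mul (hs : Summable fun k => 1 - ‖((b k).a : ℂ)‖)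
    (hΨ : TendstoLocallyUniformly
      (fun (n : ℕ) (z : 𝔻) => ∏ k ∈ Finset.range n, (b k).eval z) Ψ atTop)
    {f : 𝔻 → ℂ} (hf : f ∈ Hp p hp) :
    Ψ * f ∈ Hp p hp ∧ hpSup p (Ψ * f) = hpSup p f := by
  have hp0 : 0 ≤ p := by linarith
  have hmul := mul_mem_Hp (isAnalytic_blaschke hΨ) (norm_blaschke_le_one hΨ) hf
  refine ⟨hmul.1, le_antisymm hmul.2 (hpSup_le fun r hr => ?_)⟩
  obtain ⟨T, hTa, hTb, hT, hT1⟩ := exists_blaschke_tail hs hΨ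
  have hTf : ∀ n, T n * f ∈ Hp p hp := fun n => (mul_mem_Hp (hTa n) (hTb n) hf).1
  -- In modulus `Ψ f` is a finite product of automorphisms times `T n f`, and such a product does
  -- not decrease the norm. On the fixed circle `T n f` then tends boundedly to `f`.
  have hle : ∀ n, hpMean p (T n * f) r ≤ hpSup p (Ψ * f) := fun n => by
    refine (hpMean_le_hpSup (hTf n) hr).trans ((hpSup_le_prod_eval_mul b n (hTf n)).trans_eq ?_)
    refine hpSup_congr fun z => ?_
    rw [Pi.mul_apply, norm_mul, norm_mul, Pi.mul_apply, norm_mul, hT n z, mul_assoc]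
  obtain ⟨M, hM⟩ := (isCompact_sphere (0 : ℂ) r).exists_bound_of_continuousOn
    (hf.1.continuousOn.mono (sphere_subset_ball hr))
  have hM0 : 0 ≤ M := (norm_nonneg _).trans (hM (r : ℂ) (by simp [abs_of_pos hr.1]))
  have hlim := tendsto_circleAverage_of_bounded (l := atTop)
    (F := fun n z => ‖zeroExt (T n * f) z‖ ^ p) (f := fun z => ‖zeroExt f z‖ ^ p) hr.1.le (M ^ p)
    (Eventually.of_forall fun n => ?_) (Eventually.of_forall fun n z hz => ?_) fun z hz => ?_
  · exact le_of_tendsto hlim (Eventually.of_forall hle)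
  · exact ((hTf n).1.continuousOn.mono (sphere_subset_ball hr)).norm.rpow_const
      fun _ _ => Or.inr hp0
  · have hz1 : ‖z‖ < 1 := by simpa using sphere_subset_ball hr hz
    have h1 := hM z hz
    rw [zeroExt_of_lt _ hz1] at h1
    rw [abs_of_nonneg (by positivity), zeroExt_of_lt _ hz1, Pi.mul_apply, norm_mul]
    refine Real.rpow_le_rpow (by positivity) ?_ hp0
    exact (mul_le_of_le_one_left (norm_nonneg _) (hTb n _)).trans h1
  · have hz1 : ‖z‖ < 1 := by simpa using sphere_subset_ball hr hz
    simp only [zeroExt_of_lt _ hz1, Pi.mul_apply]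
    have := (((hT1 (Complex.UnitDisc.mk z hz1)).mul_const
      (f (Complex.UnitDisc.mk z hz1))).norm).rpow_const (p := p) (Or.inr hp0)
    simpa using this

theorem isHpIsometry_mulOp_mul_U (φ : DiscAut) (hs : Summable fun k => 1 - ‖((b k).a : ℂ)‖)
    (hΨ : TendstoLocallyUniformly
      (fun (n : ℕ) (z : 𝔻) => ∏ k ∈ Finset.range n, (b k).eval z) Ψ atTop) :
    IsHpIsometry p hp (mulOp Ψ * U p φ) := fun f hf => by
  have h := hpSup_blaschke_mul hs hΨ (φ.U_mem_Hp hf)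
  exact ⟨h.1, by rw [hpNorm_eq, hpNorm_eq, ← φ.hpSup_U hf, ← h.2]; rfl⟩

/-! ### Infinite codimension of the range -/

theorem infinite_range_zeros (hs : Summable fun k => 1 - ‖((b k).a : ℂ)‖) :
    (Set.range fun k => (b k).a).Infinite := by
  intro hfin
  obtain ⟨a, -, ha⟩ := Set.exists_max_image _ (fun a : 𝔻 => ‖(a : ℂ)‖) hfin ⟨_, 0, rfl⟩
  have h1 := ge_of_tendsto hs.tendsto_atTop_zero (b := 1 - ‖(a : ℂ)‖)
    (Eventually.of_forall fun k => sub_le_sub_left (ha _ ⟨k, rfl⟩) 1)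
  linarith [a.norm_lt_one]

theorem polynomial_mem_Hp (P : Polynomial ℂ) : (fun z : 𝔻 => P.eval (z : ℂ)) ∈ Hp p hp := by
  obtain ⟨C, hC⟩ := (isCompact_closedBall (0 : ℂ) 1).exists_bound_of_continuousOn
    P.continuous.continuousOn
  refine mem_Hp_of_bounded (isAnalytic_of_eq P.differentiable.differentiableOn fun _ => rfl)
    (C := C) fun z => hC z (by simpa using z.norm_lt_one.le)

/-- If the codimension were `d`, evaluation at `d + 1` points of `Z` would factor through the
quotient, yet Lagrange interpolation by polynomials makes it onto. -/
theorem hasInfiniteCodim_of_zeros {S : Module.End ℂ (𝔻 → ℂ)} {Z : Set 𝔻} (hZ : Z.Infinite)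
    (hS : ∀ f, ∀ z ∈ Z, S f z = 0) : HasInfiniteCodim p hp S := by
  classical
  intro hfd
  set N := ((Hp p hp).map S).submoduleOf (Hp p hp)
  set d := Module.finrank ℂ (Hp p hp ⧸ N)
  obtain ⟨s, hsZ, hsc⟩ := hZ.exists_subset_card_eq (d + 1)
  let ev : Hp p hp →ₗ[ℂ] (s → ℂ) :=
    (LinearMap.funLeft ℂ ℂ (fun z : s => (z : 𝔻))).comp (Hp p hp).subtype
  have hker : N ≤ LinearMap.ker ev := by
    rintro ⟨f, hf⟩ ⟨g, -, hg⟩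
    rw [LinearMap.mem_ker]
    funext z
    have : f = S g := hg.symm
    exact (congrFun this z).trans (hS g z (hsZ z.2))
  have hsurj : Function.Surjective (N.liftQ ev hker) := by
    intro v
    let P := Lagrange.interpolate Finset.univ (fun z : s => ((z : 𝔻) : ℂ)) v
    refine ⟨N.mkQ ⟨_, polynomial_mem_Hp P⟩, ?_⟩
    rw [Submodule.mkQ_apply, Submodule.liftQ_apply]
    funext z
    exact Lagrange.eval_interpolate_at_node v
      (fun x _ y _ h => Subtype.ext (Complex.UnitDisc.coe_injective h)) (Finset.mem_univ z)
  have := LinearMap.finrank_le_finrank_of_surjective hsurj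
  rw [Module.finrank_fintype_fun_eq_card, Fintype.card_coe, hsc] at this
  omega

theorem hasInfiniteCodim_mulOp_mul_U (φ : DiscAut) (hs : Summable fun k => 1 - ‖((b k).a : ℂ)‖)
    (hΨ : TendstoLocallyUniformly
      (fun (n : ℕ) (z : 𝔻) => ∏ k ∈ Finset.range n, (b k).eval z) Ψ atTop) :
    HasInfiniteCodim p hp (mulOp Ψ * U p φ) := by
  refine hasInfiniteCodim_of_zeros (infinite_range_zeros hs) ?_
  rintro f _ ⟨k, rfl⟩
  change Ψ (b k).a * _ = 0
  rw [blaschke_apply_zero hΨ k, zero_mul]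

end Blaschke

/-! ### Powers of the isometry -/

/-- Separates the invertible part `U^n` from the multiplier, so membership in the range of `S^n`
becomes divisibility by `∏_{j<n} Ψ ∘ φ^j` in `H^p`. -/
theorem mulOp_mul_U_pow_apply (p : ℝ) (φ : DiscAut) (Ψ g : 𝔻 → ℂ) (n : ℕ) (z : 𝔻) :
    ((mulOp Ψ * U p φ) ^ n) g z =
      (∏ j ∈ Finset.range n, Ψ (φ.map^[j] z)) * ((U p φ ^ n) g) z := by
  induction n generalizing z with
  | zero => simp
  | succ n ih =>
    have h1 : ((mulOp Ψ * U p φ) ^ (n + 1)) g z =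
        Ψ z * (φ.weightExt p z * (((mulOp Ψ * U p φ) ^ n) g) (φ.map z)) := by
      rw [pow_succ', Module.End.mul_apply]
      rfl
    have h2 : ((U p φ ^ (n + 1)) g) z = φ.weightExt p z * ((U p φ ^ n) g) (φ.map z) := by
      rw [pow_succ', Module.End.mul_apply, DiscAut.U_apply]
    rw [h1, h2, ih, Finset.prod_range_succ']
    simp only [Function.iterate_succ_apply, Function.iterate_zero_apply]
    ring

theorem IsAnalytic.comp_map {f : 𝔻 → ℂ} (hf : IsAnalytic f) (φ : DiscAut) :
    IsAnalytic (f ∘ φ.map) := by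
  refine isAnalytic_of_eq (F := fun z => zeroExt f (φ.eval z))
    (DifferentiableOn.comp hf φ.differentiableOn_eval_ball fun z hz => ?_) fun z => ?_
  · simpa using φ.norm_eval_lt_one z (by simpa using hz)
  · rw [← DiscAut.coe_map, zeroExt_coe]; rfl

theorem IsAnalytic.comp_iterate_map {f : 𝔻 → ℂ} (hf : IsAnalytic f) (φ : DiscAut) (n : ℕ) :
    IsAnalytic (f ∘ φ.map^[n]) := by
  induction n with
  | zero => exact hf
  | succ n ih => rw [Function.iterate_succ, ← Function.comp_assoc]; exact ih.comp_map φ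

/-! ### The two choices of Blaschke product -/

theorem IsAnalytic.eq_zero_of_tendsto {f : 𝔻 → ℂ} (hf : IsAnalytic f) {c : ℕ → 𝔻}
    (hc : Tendsto (fun k => (c k : ℂ)) atTop (𝓝 0)) (hc0 : ∀ k, c k ≠ 0)
    (h : ∀ k, f (c k) = 0) : f = 0 := by
  have h1 : Tendsto (fun k => (c k : ℂ)) atTop (𝓝[≠] 0) :=
    tendsto_nhdsWithin_iff.2 ⟨hc, Eventually.of_forall fun k => by simpa using hc0 k⟩
  have h2 : ∃ᶠ z in 𝓝[≠] (0 : ℂ), zeroExt f z = 0 :=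
    h1.frequently (Frequently.of_forall fun k => by rw [zeroExt_coe, h])
  have h3 := (DifferentiableOn.analyticOnNhd hf
    Metric.isOpen_ball).eqOn_zero_of_preconnected_of_frequently_eq_zero
      (convex_ball (0 : ℂ) 1).isPreconnected (by simp) h2
  funext z
  rw [← zeroExt_coe f z]
  exact h3 (by simpa using z.norm_lt_one)

variable {p : ℝ} {hp : 1 ≤ p}

/-- There is a Blaschke product for which the isometry is completely non-unitary. -/
theorem exists_iInf_eq_bot (φ : DiscAut)
    (hsum : ∀ c : 𝔻, Summable fun n : ℕ => 1 - ‖((φ.map^[n] c : 𝔻) : ℂ)‖) :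
    ∃ Ψ : 𝔻 → ℂ, IsInfiniteBlaschkeProduct Ψ ∧
      (⨅ n : ℕ, (Hp p hp).map ((mulOp Ψ * U p φ) ^ (n + 1))) = ⊥ := by
  have hclt : ∀ k : ℕ, ‖(((k : ℝ) + 2)⁻¹ : ℂ)‖ < 1 := fun k => by
    rw [← Complex.ofReal_ofNat, ← Complex.ofReal_add, ← Complex.ofReal_inv, Complex.norm_real,
      Real.norm_of_nonneg (by positivity)]
    exact inv_lt_one_of_one_lt₀ (by linarith [Nat.cast_nonneg (α := ℝ) k])
  let c : ℕ → 𝔻 := fun k => Complex.UnitDisc.mk _ (hclt k)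
  -- The orbit of `c k` approaches the circle, so one of its points can serve as a zero of `Ψ` with
  -- geometrically small defect.
  have hn : ∀ k, ∃ n : ℕ, 1 - ‖((φ.map^[n] (c k) : 𝔻) : ℂ)‖ ≤ (1 / 2) ^ k := fun k =>
    ((hsum (c k)).tendsto_atTop_zero.eventually_le_const (by positivity)).exists
  choose n hn using hn
  have hs : Summable fun k => 1 - ‖((φ.map^[n k] (c k) : 𝔻) : ℂ)‖ :=
    Summable.of_nonneg_of_le (fun k => by linarith [(φ.map^[n k] (c k)).norm_lt_one]) hn
      summable_geometric_two
  obtain ⟨b, Ψ, hb, hΨ⟩ := exists_blaschke _ hs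
  have hs' : Summable fun k => 1 - ‖((b k).a : ℂ)‖ := by simpa only [hb] using hs
  refine ⟨Ψ, ⟨b, hs', hΨ⟩, ?_⟩
  rw [eq_bot_iff]
  intro f hf
  rw [Submodule.mem_iInf] at hf
  have hfa : IsAnalytic f := by
    obtain ⟨g, hg, rfl⟩ := hf 0
    rw [zero_add, pow_one]
    exact (isHpIsometry_mulOp_mul_U φ hs' hΨ g hg).1.1
  refine (Submodule.mem_bot ℂ).2 (hfa.eq_zero_of_tendsto (c := c) ?_ (fun k h => ?_) fun k => ?_)
  · have h1 : Tendsto (fun k : ℕ => (((k : ℝ) + 2)⁻¹ : ℝ)) atTop (𝓝 0) :=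
      tendsto_inv_atTop_zero.comp
        (tendsto_atTop_add_const_right _ _ tendsto_natCast_atTop_atTop)
    have h2 := (Complex.continuous_ofReal.tendsto 0).comp h1
    refine (h2.congr fun k => ?_)
    simp [c]
  · rw [← Complex.UnitDisc.coe_eq_zero] at h
    have h1 : ((k : ℝ) + 2 : ℂ) ≠ 0 := by
      exact_mod_cast (by positivity : ((k : ℝ) + 2) ≠ 0)
    exact inv_ne_zero h1 h
  -- Index `n k` means the power `n k + 1`, whose multiplier includes the factor `Ψ ∘ φ^(n k)`; that
  -- factor vanishes at `c k`.
  · obtain ⟨g, -, rfl⟩ := hf (n k)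
    rw [mulOp_mul_U_pow_apply, Finset.prod_eq_zero (Finset.mem_range.2 (Nat.lt_succ_self (n k))),
      zero_mul]
    rw [← hb]
    exact blaschke_apply_zero hΨ k

theorem one_sub_sum_le_prod {ι : Type*} (s : Finset ι) (x : ι → ℝ) (h0 : ∀ i, 0 ≤ x i)
    (h1 : ∀ i, x i ≤ 1) : 1 - ∑ i ∈ s, x i ≤ ∏ i ∈ s, (1 - x i) := by
  classical
  induction s using Finset.induction_on with
  | empty => simp
  | insert a s ha ih =>
    rw [Finset.sum_insert ha, Finset.prod_insert ha]
    have h2 : ∏ i ∈ s, (1 - x i) ≤ 1 :=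
      Finset.prod_le_one (fun i _ => by linarith [h1 i]) fun i _ => by linarith [h0 i]
    nlinarith [h0 a, h1 a]

/-- There is a Blaschke product which stays close to one along an orbit. -/
theorem exists_blaschke_near_one_on_orbit (φ : DiscAut)
    (hsum : Summable fun n : ℕ => 1 - ‖((φ.map^[n] 0 : 𝔻) : ℂ)‖) :
    ∃ (b : ℕ → DiscAut) (Ψ : 𝔻 → ℂ), Summable (fun k => 1 - ‖((b k).a : ℂ)‖) ∧
      TendstoLocallyUniformly
        (fun (n : ℕ) (z : 𝔻) => ∏ k ∈ Finset.range n, (b k).eval z) Ψ atTop ∧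
      (∀ j, Ψ (φ.map^[j] 0) ≠ 0) ∧ Summable fun j : ℕ => 1 - ‖Ψ (φ.map^[j] 0)‖ := by
  set d : ℕ → ℝ := fun n => 1 - ‖((φ.map^[n] 0 : 𝔻) : ℂ)‖ with hd
  have hd0 : ∀ n, 0 ≤ d n := fun n => by simp only [hd]; linarith [(φ.map^[n] 0).norm_lt_one]
  have hd1 : ∀ n, d n ≤ 1 := fun n => by
    simp only [hd]; linarith [norm_nonneg ((φ.map^[n] 0 : 𝔻) : ℂ)]
  -- The geometric factor makes the double series of defects converge; the quarter bounds its total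
  -- by `1 / 2`, which keeps `Ψ` away from zero on the orbit.
  have hm : ∀ k : ℕ, ∃ m, ∑' j, d (j + m) ≤ (1 / 2) ^ k / 4 := fun k =>
    ((tendsto_sum_nat_add d).eventually_le_const (by positivity)).exists
  choose m hm using hm
  have hdm : ∀ k, Summable fun j => d (j + m k) := fun k => (summable_nat_add_iff (m k)).2 hsum
  have hle : ∀ k j, d (j + m k) ≤ (1 / 2) ^ k / 4 := fun k j =>
    ((hdm k).le_tsum j fun i _ => hd0 _).trans (hm k)
  have hgeo : HasSum (fun k : ℕ => ((1 : ℝ) / 2) ^ k / 4) (2 / 4) := hasSum_geometric_two.div_const 4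
  have hnorm : ∀ k (z : 𝔻), ‖(DiscAut.ofZero (φ.inv.map^[m k] 0)).eval z‖ =
      ‖((φ.map^[m k] z : 𝔻) : ℂ)‖ := fun k z => φ.norm_ofZero_iterate_inv (m k) z
  have ha : ∀ k, 1 - ‖((φ.inv.map^[m k] 0 : 𝔻) : ℂ)‖ = d (m k) := fun k => by
    have := hnorm k 0
    rw [Complex.UnitDisc.coe_zero, DiscAut.norm_eval_zero] at this
    simp only [hd, ← this]
    rfl
  have hs : Summable fun k => 1 - ‖((φ.inv.map^[m k] 0 : 𝔻) : ℂ)‖ := by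
    simp only [ha]
    exact Summable.of_nonneg_of_le (fun k => hd0 _) (fun k => by simpa using hle k 0) hgeo.summable
  obtain ⟨b, Ψ, hb, hΨ⟩ := exists_blaschke _ hs
  have hbz : ∀ k j, ‖(b k).eval (φ.map^[j] 0 : 𝔻)‖ = 1 - d (j + m k) := fun k j => by
    rw [DiscAut.norm_eval_eq_ofZero, hb, hnorm, ← Function.iterate_add_apply]
    simp only [hd, sub_sub_cancel, add_comm]
  have hdk : ∀ j, Summable fun k => d (j + m k) := fun j =>
    Summable.of_nonneg_of_le (fun k => hd0 _) (fun k => hle k j) hgeo.summable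
  have hlow : ∀ j, 1 - ∑' k, d (j + m k) ≤ ‖Ψ (φ.map^[j] 0)‖ := fun j => by
    refine ge_of_tendsto (tendsto_of_tendstoLocallyUniformly hΨ (φ.map^[j] 0)).norm
      (Eventually.of_forall fun n => ?_)
    simp only [norm_prod, hbz]
    refine le_trans (sub_le_sub_left ?_ 1)
      (one_sub_sum_le_prod _ (fun k => d (j + m k)) (fun k => hd0 _) fun k => hd1 _)
    exact (hdk j).sum_le_tsum _ fun k _ => hd0 _
  have hhalf : ∀ j, ∑' k, d (j + m k) ≤ 2 / 4 := fun j => by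
    rw [← hgeo.tsum_eq]
    exact (hdk j).tsum_le_tsum (fun k => hle k j) hgeo.summable
  -- Summed over `j` first, the series is controlled by the choice of `m`; summed over `k` first, it
  -- majorizes the defects `1 - |Ψ (φ^j 0)|`.
  have hdouble : Summable fun q : ℕ × ℕ => d (q.2 + m q.1) := by
    refine (summable_prod_of_nonneg fun q => hd0 _).2 ⟨hdm, ?_⟩
    exact Summable.of_nonneg_of_le (fun k => tsum_nonneg fun j => hd0 _) hm hgeo.summable
  refine ⟨b, Ψ, by simpa only [hb] using hs, hΨ, fun j h0 => ?_, ?_⟩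
  · have := hlow j
    rw [h0, norm_zero] at this
    linarith [hhalf j]
  · refine Summable.of_nonneg_of_le (fun j => by linarith [norm_blaschke_le_one hΨ (φ.map^[j] 0)])
      (fun j => ?_) hdouble.prod_symm.prod
    have := hlow j
    simp only [Prod.fst_swap, Prod.snd_swap]
    linarith

/-- There is a Blaschke product for which the isometry has a non-trivial unitary part. -/
theorem exists_iInf_ne_bot (φ : DiscAut)
    (hsum : Summable fun n : ℕ => 1 - ‖((φ.map^[n] 0 : 𝔻) : ℂ)‖) :
    ∃ Ψ : 𝔻 → ℂ, IsInfiniteBlaschkeProduct Ψ ∧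
      (⨅ n : ℕ, (Hp p hp).map ((mulOp Ψ * U p φ) ^ (n + 1))) ≠ ⊥ := by
  obtain ⟨b, Ψ, hs, hΨ, hne, horb⟩ := exists_blaschke_near_one_on_orbit φ hsum
  have hmem : ∀ z : 𝔻, (z : ℂ) ∈ Metric.ball (0 : ℂ) 1 := fun z => by simpa using z.norm_lt_one
  have happ : ∀ j (z : 𝔻), zeroExt (Ψ ∘ φ.map^[j]) z = Ψ (φ.map^[j] z) := fun j z => by
    rw [zeroExt_coe]; rfl
  have happ0 : ∀ j, zeroExt (Ψ ∘ φ.map^[j]) 0 = Ψ (φ.map^[j] 0) := fun j => happ j 0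
  obtain ⟨u, R, hRd, hRb, hR, hR1, -⟩ := exists_product (h := fun j => zeroExt (Ψ ∘ φ.map^[j]))
    (fun j => (isAnalytic_blaschke hΨ).comp_iterate_map φ j)
    (fun j z hz => by
      rw [zeroExt_of_lt _ (by simpa using hz)]
      exact norm_blaschke_le_one hΨ _)
    (by simpa only [happ0] using horb)
  refine ⟨Ψ, ⟨b, hs, hΨ⟩, (Submodule.ne_bot_iff _).2 ⟨fun z => R 0 z, ?_, fun h0 => ?_⟩⟩
  · rw [Submodule.mem_iInf]
    intro n
    -- Dividing `R 0` by the multiplier of `S^(n+1)` leaves this bounded tail, which surjectivity of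
    -- `U^(n+1)` pulls back to an element of `H^p`.
    have hbdd : (fun z : 𝔻 => (∏ k ∈ Finset.range (n + 1), (u k : ℂ)) * R (n + 1) z) ∈ Hp p hp := by
      refine mem_Hp_of_bounded (isAnalytic_of_eq ((hRd (n + 1)).const_mul _) fun _ => rfl)
        (C := 1) fun z => ?_
      rw [norm_mul, norm_prod]
      simp only [Circle.norm_coe, Finset.prod_const_one, one_mul]
      exact hRb _ z (hmem z)
    obtain ⟨g, hg, hgU⟩ := φ.exists_U_pow_eq hbdd (n + 1)
    refine ⟨g, hg, ?_⟩
    funext z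
    rw [mulOp_mul_U_pow_apply, hgU, eq_prod_mul_tail hR (n + 1) (hmem z)]
    simp only [happ]
    ring
  -- At the origin some tail is nonzero because the tails tend to one, and the finitely many
  -- remaining factors do not vanish on the orbit of `0`.
  · obtain ⟨n, hn⟩ := ((hR1 0 (by simp)).eventually_ne one_ne_zero).exists
    have h1 : R 0 0 = 0 := congrFun h0 (0 : 𝔻)
    rw [eq_prod_mul_tail hR n (by simp)] at h1
    refine mul_ne_zero (mul_ne_zero ?_ ?_) hn h1
    · exact Finset.prod_ne_zero_iff.2 fun k _ => Circle.coe_ne_zero _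
    · refine Finset.prod_ne_zero_iff.2 fun k _ => ?_
      rw [happ0]
      exact hne k

end HardyIsometry

open HardyIsometry in
theorem proposition6 (p : ℝ) (hp : 1 ≤ p) (hp2 : p ≠ 2) (φ : DiscAut)
    (hφ : φ.IsParabolic ∨ φ.IsHyperbolic) :
    (∀ Ψ : 𝔻 → ℂ, IsInfiniteBlaschkeProduct Ψ →
      IsHpIsometry p hp (mulOp Ψ * U p φ) ∧ HasInfiniteCodim p hp (mulOp Ψ * U p φ)) ∧
    (∃ Ψ : 𝔻 → ℂ, IsInfiniteBlaschkeProduct Ψ ∧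
      (⨅ n : ℕ, (Hp p hp).map ((mulOp Ψ * U p φ) ^ (n + 1))) = ⊥) ∧
    (∃ Ψ : 𝔻 → ℂ, IsInfiniteBlaschkeProduct Ψ ∧
      (⨅ n : ℕ, (Hp p hp).map ((mulOp Ψ * U p φ) ^ (n + 1))) ≠ ⊥) := by
  obtain ⟨⟨w, hw, hfix⟩, hne⟩ := φ.exists_boundary_fixed_point hφ
  have hsum := φ.summable_one_sub_norm_iterate hw hfix hne
  refine ⟨?_, exists_iInf_eq_bot φ hsum, exists_iInf_ne_bot φ (hsum 0)⟩
  rintro Ψ ⟨b, hs, hΨ⟩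
  exact ⟨isHpIsometry_mulOp_mul_U φ hs hΨ, hasInfiniteCodim_mulOp_mul_U φ hs hΨ⟩
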